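/- Let $n\ge 2$ be an integer, let $1<p\le q<\infty$ and $\alpha>0$ satisfy $\frac qp\le 1+\frac{\alpha}{n}$, and let $B=B(x_0,R)\subset\mathbb{R}^n$ be an open ball of radius $R>0$. For a multi-index $\sigma$, $\partial_\sigma$ denotes the weak derivative and $|D^k u|=\big(\sum_{|\sigma|=k}|\partial_\sigma u|^2\big)^{1/2}$. For an integer $\ell\ge 0$ set $(q_\ell)^*=\frac{nq}{n-\ell q}$ if $\ell q<n$ and $(q_\ell)^*=\infty$ otherwise. Let $a:B\to[0,\infty)$ be a measurable function for which there is a constant $C>0$ with $a(x)\le C\,(a(y)+|x-y|^\alpha)$ for all $x,y\in B$; let $[a]_\alpha$ be the infimum of such $C$. Let $\eta\in L^\infty(B)$ with $0\le\eta\le1$ and $\|\eta\|_{L^1(B)}\ge|B(x_0,R/2)|$, and write $f_{B,\eta}=\|\eta\|_{L^1(B)}^{-1}\int_B f\eta$. Let $\ell\ge0$ be an integer, and let $r\in[1,(q_\ell)^*]$ if $\ell q<n$, and $r\in[1,(q_\ell)^*)=[1,\infty)$ if $\ell q\ge n$. Then there is a constant $c>0$, depending only on $n,\ell,p,q,r,\alpha$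 and $[a]_\alpha$, such that every real-valued $u\in W^{\ell,p}(B)$ with $$\int_B a\,|D^\ell u|^q<\infty\qquad\text{and}\qquad(\partial_\sigma u)_{B,\eta}=0\ \text{ for every multi-index }\sigma\text{ with }|\sigma|\le\ell-1$$ satisfies $$\Big(\frac1{|B|}\int_B a^{\frac rq}\Big|\frac{u}{R^\ell}\Big|^r\Big)^{\frac1r}\le c\Big(\frac1{|B|}\int_B a\,|D^\ell u|^q\Big)^{\frac1q}+c\,R^{\frac\alpha q}\Big(\frac1{|B|}\int_B|D^\ell u|^p\Big)^{\frac1p};$$ in particular the left-hand side is finite. Moreover, for $\ell=1$ and $r=q$ (which is always admissible), there is a constant $c>0$ depending only on $n,p,q,\alpha$ and $[a]_\alpha$ such that $$\Big(\frac1{|B|}\int_B a\Big|\frac uR\Big|^q\Big)^{\frac1q}\le c\Big(\frac1{|B|}\int_B a\,|Du|^q\Big)^{\frac1q}+c\,R^{\frac\alpha q}\Big(\frac1{|B|}\int_B|Du|^p\Big)^{\frac1p}$$ for every $u\in W^{1,p}(B)$ with $\int_B a|Du|^q<\infty$ and $u_{B,\eta}=0$. -/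

import Mathlib

open Set MeasureTheory
open scoped ENNReal ContDiff

noncomputable section

/-- The partial derivative `∂ᵢ f` of a function on `ℝⁿ`. -/
def partialDeriv {n : ℕ} (i : Fin n) (f : EuclideanSpace ℝ (Fin n) → ℝ) :
    EuclideanSpace ℝ (Fin n) → ℝ :=
  fun x => fderiv ℝ f x (EuclideanSpace.single i 1)

/-- The partial derivative `∂_σ f = ∂₁^{σ₁} ⋯ ∂ₙ^{σₙ} f` for a multi-index `σ`. -/
def multiDeriv {n : ℕ} (σ : Fin n → ℕ) (f : EuclideanSpace ℝ (Fin n) → ℝ) :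
    EuclideanSpace ℝ (Fin n) → ℝ :=
  (List.finRange n).foldr (fun i g => (partialDeriv i)^[σ i] g) f

/-- `g` is a weak derivative `∂_σ u` of `u` in the open set `Ω`: both are locally integrable in `Ω`
and `∫_Ω u ∂_σ φ = (-1)^{|σ|} ∫_Ω g φ` for all `φ ∈ C_c^∞(Ω)`. -/
def HasWeakDeriv {n : ℕ} (Ω : Set (EuclideanSpace ℝ (Fin n))) (σ : Fin n → ℕ)
    (u g : EuclideanSpace ℝ (Fin n) → ℝ) : Prop :=
  LocallyIntegrableOn u Ω volume ∧ LocallyIntegrableOn g Ω volume ∧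
    ∀ φ : EuclideanSpace ℝ (Fin n) → ℝ, ContDiff ℝ ∞ φ → HasCompactSupport φ → tsupport φ ⊆ Ω →
      ∫ x in Ω, u x * multiDeriv σ φ x = (-1) ^ (∑ i, σ i) * ∫ x in Ω, g x * φ x

/-- `u ∈ W^{ℓ,p}(Ω)`: `u` and all its weak derivatives of order at most `ℓ` lie in `L^p(Ω)`. -/
def MemSobolev {n : ℕ} (ℓ : ℕ) (p : ℝ≥0∞) (Ω : Set (EuclideanSpace ℝ (Fin n)))
    (u : EuclideanSpace ℝ (Fin n) → ℝ) : Prop :=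
  MemLp u p (volume.restrict Ω) ∧
    ∀ σ : Fin n → ℕ, ∑ i, σ i ≤ ℓ →
      ∃ g, MemLp g p (volume.restrict Ω) ∧ HasWeakDeriv Ω σ u g

open Classical in
/-- The weak derivative `∂_σ u` in `Ω` (unique up to a null subset of `Ω`; zero if there is none). -/
def weakDeriv {n : ℕ} (Ω : Set (EuclideanSpace ℝ (Fin n))) (σ : Fin n → ℕ)
    (u : EuclideanSpace ℝ (Fin n) → ℝ) : EuclideanSpace ℝ (Fin n) → ℝ :=
  if h : ∃ g, HasWeakDeriv Ω σ u g then h.choose else 0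

/-- `|D^k u|(x)`, the Euclidean norm of the array of all weak derivatives of order exactly `k`. -/
def normD {n : ℕ} (Ω : Set (EuclideanSpace ℝ (Fin n))) (k : ℕ)
    (u : EuclideanSpace ℝ (Fin n) → ℝ) (x : EuclideanSpace ℝ (Fin n)) : ℝ :=
  √(∑ σ ∈ Finset.piAntidiag (Finset.univ : Finset (Fin n)) k, weakDeriv Ω σ u x ^ 2)

/-- The constants `C > 0` with `a(x) ≤ C (a(y) + |x - y|^α)` for all `x, y ∈ Ω`. -/
def zConstants {n : ℕ} (α : ℝ) (Ω : Set (EuclideanSpace ℝ (Fin n)))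
    (a : EuclideanSpace ℝ (Fin n) → ℝ) : Set ℝ :=
  {C | 0 < C ∧ ∀ x ∈ Ω, ∀ y ∈ Ω, a x ≤ C * (a y + ‖x - y‖ ^ α)}

/-- The class `𝒵^α(Ω)` of (Lebesgue) measurable functions `a : Ω → [0,∞)`; values of `a` outside
`Ω` play no role. -/
def MemZ {n : ℕ} (α : ℝ) (Ω : Set (EuclideanSpace ℝ (Fin n)))
    (a : EuclideanSpace ℝ (Fin n) → ℝ) : Prop :=
  AEMeasurable a (volume.restrict Ω) ∧ (∀ x ∈ Ω, 0 ≤ a x) ∧ (zConstants α Ω a).Nonempty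

/-- `[a]_{α,Ω}`, the infimum of the admissible constants. -/
def zSeminorm {n : ℕ} (α : ℝ) (Ω : Set (EuclideanSpace ℝ (Fin n)))
    (a : EuclideanSpace ℝ (Fin n) → ℝ) : ℝ :=
  sInf (zConstants α Ω a)

/-- The weighted mean `f_{B,η} = ‖η‖_{L¹(B)}⁻¹ ∫_B f η`. -/
def weightedMean {n : ℕ} (B : Set (EuclideanSpace ℝ (Fin n)))
    (η f : EuclideanSpace ℝ (Fin n) → ℝ) : ℝ :=
  (∫ x in B, |η x|)⁻¹ * ∫ x in B, f x * η x

/-- The weights allowed on the ball `B = B(x₀,R)`: `η ∈ L^∞(B)`, `0 ≤ η ≤ 1` and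
`‖η‖_{L¹(B)} ≥ |B/2|`, where `B/2 = B(x₀,R/2)`. -/
def IsBallWeight {n : ℕ} (x₀ : EuclideanSpace ℝ (Fin n)) (R : ℝ)
    (η : EuclideanSpace ℝ (Fin n) → ℝ) : Prop :=
  MemLp η ⊤ (volume.restrict (Metric.ball x₀ R)) ∧
    (∀ᵐ x ∂(volume.restrict (Metric.ball x₀ R)), 0 ≤ η x ∧ η x ≤ 1) ∧
    volume.real (Metric.ball x₀ (R / 2)) ≤ ∫ x in Metric.ball x₀ R, |η x|

/-- The exponent `(t_ℓ)^*`: `nt/(n - ℓt)` if `ℓt < n`, and `∞` otherwise. -/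
def sobolevExponent (n ℓ : ℕ) (t : ℝ) : ℝ≥0∞ :=
  if (ℓ : ℝ) * t < n then ENNReal.ofReal (n * t / (n - ℓ * t)) else ⊤

end

/-!
The heart of the matter is a pointwise bound. If `v` has vanishing weighted mean on the ball `B`,
then for almost every `x ∈ B`
`|v(x)| ≤ c ∫_B |Dv(y)| |x - y|^(1 - n) dy`, a Riesz potential of order one
(`enorm_le_rieszPotential`). For smooth functions this is the fundamental theorem of calculus on
segments, followed by the substitution `z = x + t (y - x)` (`lintegral_enorm_sub_le`); mollification
extends it to weakly differentiable functions, because convolution with the mollifier commutes with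
Riesz potentials (`lintegral_enorm_sub_le_of_hasWeakDeriv`). The weight `η` only enters through
`0 ≤ η ≤ 1` and `‖η‖_{L¹} ≥ |B/2|`.

Multiply by `a(x)^(1/q)`. Since `a(x)^(1/q) ≤ C (a(y)^(1/q) + |x - y|^(α/q))`, the weight can be
moved under the integral at the price of a second potential of order `1 + α/q` (`mul_rieszPotential_le`):
the first potential acts on `a^(1/q) |Dv|`, which is controlled in terms of `L^q`, the second one on
`|Dv|`, which is controlled in terms of `L^p`. The Hardy-Littlewood-Sobolev inequality
(`eLpNorm'_rieszPotential_le`, proved from the maximal function by Hedberg's argument) gains `1/n` in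
the reciprocal of the exponent in the first case and `(1 + α/q)/n` in the second. The hypothesis
`q/p ≤ 1 + α/n` says precisely that `1/p - α/(qn) ≤ 1/q`, so the second term lands in the same
space as the first.

Higher orders follow by applying this step to the derivatives of order `ℓ - 1, ℓ - 2, …, 0` in turn
(`eLpNorm'_weight_mul_le_of_rieszPotential_chain`). Each step gains `1/n`, so that all exponents
`r ≥ 1` with `1/q - ℓ/n ≤ 1/r` are reached (`weighted_sobolev_poincare`); this single condition
covers both the subcritical range `ℓ q < n` and the range `ℓ q ≥ n`. Throughout, averages over `B` are
`L^r` norms for the normalised measure `ballMeasure`, and nonnegative functions take values in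
`ℝ≥0∞`, so that no integrability needs to be known in advance.
-/

open scoped Convolution Topology

/-! ### The dyadic Hardy-Littlewood maximal function -/

/-- The centred Hardy-Littlewood maximal function over closed balls. Only the radii `2 ^ k` with
`k ∈ ℤ` are used, so that the supremum is countable; this changes it at most by the factor `2 ^ n`. -/
noncomputable def maximalFn {n : ℕ} (f : EuclideanSpace ℝ (Fin n) → ℝ≥0∞)
    (x : EuclideanSpace ℝ (Fin n)) : ℝ≥0∞ :=
  ⨆ k : ℤ, (volume (Metric.closedBall x ((2 : ℝ) ^ k)))⁻¹ *
    ∫⁻ y in Metric.closedBall x ((2 : ℝ) ^ k), f y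

theorem volume_closedBall_euclidean {n : ℕ} (x : EuclideanSpace ℝ (Fin n)) {r : ℝ} (hr : 0 ≤ r) :
    volume (Metric.closedBall x r) =
      ENNReal.ofReal (r ^ n) * volume (Metric.ball (0 : EuclideanSpace ℝ (Fin n)) 1) := by
  rw [Measure.addHaar_closedBall _ _ hr, finrank_euclideanSpace_fin]

theorem measurable_lintegral_closedBall {n : ℕ} {f : EuclideanSpace ℝ (Fin n) → ℝ≥0∞}
    (hf : Measurable f) (r : ℝ) :
    Measurable fun x => ∫⁻ y in Metric.closedBall x r, f y := by
  have h : ∀ x, ∫⁻ y in Metric.closedBall x r, f y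
      = ∫⁻ y, {z : EuclideanSpace ℝ (Fin n) × EuclideanSpace ℝ (Fin n) |
          dist z.2 z.1 ≤ r}.indicator (fun z => f z.2) (x, y) := by
    intro x
    rw [← lintegral_indicator Metric.isClosed_closedBall.measurableSet]
    rfl
  simp_rw [h]
  refine Measurable.lintegral_prod_right' (f := fun z => _) ?_
  refine (hf.comp measurable_snd).indicator ?_
  exact measurableSet_le (measurable_snd.dist measurable_fst) measurable_const

theorem measurable_maximalFn {n : ℕ} {f : EuclideanSpace ℝ (Fin n) → ℝ≥0∞} (hf : Measurable f) :
    Measurable (maximalFn f) := by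
  refine Measurable.iSup fun k => ?_
  have : ∀ x : EuclideanSpace ℝ (Fin n), volume (Metric.closedBall x ((2 : ℝ) ^ k)) =
      volume (Metric.closedBall (0 : EuclideanSpace ℝ (Fin n)) ((2 : ℝ) ^ k)) := fun x =>
    Measure.addHaar_closedBall_center _ _ _
  simp_rw [this]
  exact (measurable_lintegral_closedBall hf _).const_mul _

theorem lintegral_closedBall_le_maximalFn {n : ℕ} (f : EuclideanSpace ℝ (Fin n) → ℝ≥0∞)
    (x : EuclideanSpace ℝ (Fin n)) {r : ℝ} (hr : 0 < r) :
    ∫⁻ y in Metric.closedBall x r, f y ≤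
      ENNReal.ofReal ((2 * r) ^ n) * volume (Metric.ball (0 : EuclideanSpace ℝ (Fin n)) 1) *
        maximalFn f x := by
  obtain ⟨k, hk1, hk2⟩ := exists_mem_Ico_zpow (x := r) (y := (2 : ℝ)) hr (by norm_num)
  have h2 : (0 : ℝ) < 2 ^ (k + 1) := by positivity
  set V := volume (Metric.closedBall x ((2 : ℝ) ^ (k + 1))) with hV
  have hV0 : V ≠ 0 := (Metric.measure_closedBall_pos _ _ h2).ne'
  have hVt : V ≠ ⊤ := measure_closedBall_lt_top.ne
  calc ∫⁻ y in Metric.closedBall x r, f y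
      ≤ ∫⁻ y in Metric.closedBall x ((2 : ℝ) ^ (k + 1)), f y :=
        lintegral_mono_set (Metric.closedBall_subset_closedBall hk2.le)
    _ = V * (V⁻¹ * ∫⁻ y in Metric.closedBall x ((2 : ℝ) ^ (k + 1)), f y) := by
        rw [← mul_assoc, ENNReal.mul_inv_cancel hV0 hVt, one_mul]
    _ ≤ V * maximalFn f x := by
        gcongr
        exact le_iSup (fun k : ℤ => (volume (Metric.closedBall x ((2 : ℝ) ^ k)))⁻¹ *
          ∫⁻ y in Metric.closedBall x ((2 : ℝ) ^ k), f y) (k + 1)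
    _ ≤ _ := by
        rw [hV, volume_closedBall_euclidean _ h2.le]
        gcongr
        rw [zpow_add_one₀ (by norm_num)]
        linarith

/-- The weak type `(1,1)` inequality, by the Vitali covering lemma. -/
theorem mul_volume_lt_maximalFn_le {n : ℕ} {f : EuclideanSpace ℝ (Fin n) → ℝ≥0∞} (l : ℝ≥0∞) :
    l * volume {x | l < maximalFn f x} ≤ 4 ^ n * ∫⁻ y, f y := by
  set S : ℕ → Set (EuclideanSpace ℝ (Fin n)) := fun K =>
    {x | ∃ k : ℤ, k ≤ K ∧ l * volume (Metric.closedBall x ((2 : ℝ) ^ k)) ≤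
      ∫⁻ y in Metric.closedBall x ((2 : ℝ) ^ k), f y} with hS
  have hsub : {x | l < maximalFn f x} ⊆ ⋃ K, S K := by
    intro x hx
    have hx' : l < maximalFn f x := hx
    obtain ⟨k, hk⟩ := lt_iSup_iff.1 hx'
    refine mem_iUnion.2 ⟨k.toNat, k, Int.self_le_toNat k, ?_⟩
    have hV0 : volume (Metric.closedBall x ((2 : ℝ) ^ k)) ≠ 0 :=
      (Metric.measure_closedBall_pos _ _ (by positivity)).ne'
    have hVt : volume (Metric.closedBall x ((2 : ℝ) ^ k)) ≠ ⊤ := measure_closedBall_lt_top.ne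
    calc l * volume (Metric.closedBall x ((2 : ℝ) ^ k))
        ≤ ((volume (Metric.closedBall x ((2 : ℝ) ^ k)))⁻¹ *
          ∫⁻ y in Metric.closedBall x ((2 : ℝ) ^ k), f y) *
            volume (Metric.closedBall x ((2 : ℝ) ^ k)) := by gcongr
      _ = _ := by
        rw [mul_comm, ← mul_assoc, ENNReal.mul_inv_cancel hV0 hVt, one_mul]
  have hmono : Monotone S := by
    rintro K K' hK x ⟨k, hk, h⟩
    exact ⟨k, hk.trans (by exact_mod_cast hK), h⟩
  have key : ∀ K, l * volume (S K) ≤ 4 ^ n * ∫⁻ y, f y := by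
    intro K
    have hch : ∀ x : EuclideanSpace ℝ (Fin n), ∃ k : ℤ, x ∈ S K → k ≤ K ∧
        l * volume (Metric.closedBall x ((2 : ℝ) ^ k)) ≤
          ∫⁻ y in Metric.closedBall x ((2 : ℝ) ^ k), f y := by
      intro x
      by_cases hx : x ∈ S K
      · obtain ⟨k, hk⟩ := hx
        exact ⟨k, fun _ => hk⟩
      · exact ⟨0, fun h => absurd h hx⟩
    choose k hk using hch
    obtain ⟨u, hu, hdisj, hcov⟩ := Vitali.exists_disjoint_subfamily_covering_enlargement_closedBall
      (S K) (fun x => x) (fun x => (2 : ℝ) ^ k x) ((2 : ℝ) ^ K)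
      (fun x hx => by
        rw [← zpow_natCast]
        exact zpow_le_zpow_right₀ (by norm_num) (hk x hx).1) 4 (by norm_num)
    have hucount : u.Countable := by
      refine hdisj.countable_of_nonempty_interior fun x _ => ?_
      exact ⟨x, Metric.ball_subset_interior_closedBall (Metric.mem_ball_self (by positivity))⟩
    have hcover : S K ⊆ ⋃ b ∈ u, Metric.closedBall b (4 * (2 : ℝ) ^ k b) := by
      intro x hx
      obtain ⟨b, hb, hxb⟩ := hcov x hx
      exact mem_iUnion₂.2 ⟨b, hb, hxb (Metric.mem_closedBall_self (by positivity))⟩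
    have := hucount.to_subtype
    calc l * volume (S K)
        ≤ l * ∑' b : u, volume (Metric.closedBall (b : EuclideanSpace ℝ (Fin n))
            (4 * (2 : ℝ) ^ k b)) := by
          gcongr
          exact (measure_mono hcover).trans (measure_biUnion_le _ hucount _)
      _ = ∑' b : u, 4 ^ n * (l * volume (Metric.closedBall (b : EuclideanSpace ℝ (Fin n))
            ((2 : ℝ) ^ k b))) := by
          rw [← ENNReal.tsum_mul_left]
          congr 1 with b
          rw [volume_closedBall_euclidean _ (by positivity),
            volume_closedBall_euclidean _ (by positivity), mul_pow,
            ENNReal.ofReal_mul (by positivity)]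
          rw [show ENNReal.ofReal (4 ^ n) = 4 ^ n by
            rw [ENNReal.ofReal_pow (by norm_num)]; norm_num]
          ring
      _ ≤ ∑' b : u, 4 ^ n * ∫⁻ y in Metric.closedBall (b : EuclideanSpace ℝ (Fin n))
            ((2 : ℝ) ^ k b), f y := by
          gcongr with b
          exact (hk b (hu b.2)).2
      _ = 4 ^ n * ∫⁻ y in ⋃ b ∈ u, Metric.closedBall b ((2 : ℝ) ^ k b), f y := by
          rw [ENNReal.tsum_mul_left, lintegral_biUnion hucount
            (fun b _ => Metric.isClosed_closedBall.measurableSet) hdisj]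
      _ ≤ 4 ^ n * ∫⁻ y, f y := by
          exact mul_le_mul_right (setLIntegral_le_lintegral _ _) _
  calc l * volume {x | l < maximalFn f x} ≤ l * volume (⋃ K, S K) := by gcongr
    _ = ⨆ K, l * volume (S K) := by
        rw [hmono.measure_iUnion, ENNReal.mul_iSup]
    _ ≤ _ := iSup_le key

/-- Truncating `f` below the level `l` changes the maximal function by at most `l`. -/
theorem maximalFn_le_add {n : ℕ} (f : EuclideanSpace ℝ (Fin n) → ℝ≥0∞)
    (l : ℝ≥0∞) (x : EuclideanSpace ℝ (Fin n)) :
    maximalFn f x ≤ maximalFn ({y | l < f y}.indicator f) x + l := by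
  refine iSup_le fun k => ?_
  have hV0 : volume (Metric.closedBall x ((2 : ℝ) ^ k)) ≠ 0 :=
    (Metric.measure_closedBall_pos _ _ (by positivity)).ne'
  have hVt : volume (Metric.closedBall x ((2 : ℝ) ^ k)) ≠ ⊤ := measure_closedBall_lt_top.ne
  have h1 : ∫⁻ y in Metric.closedBall x ((2 : ℝ) ^ k), f y ≤
      (∫⁻ y in Metric.closedBall x ((2 : ℝ) ^ k), {y | l < f y}.indicator f y) +
        l * volume (Metric.closedBall x ((2 : ℝ) ^ k)) := by
    rw [← setLIntegral_const, ← lintegral_add_right _ measurable_const]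
    refine lintegral_mono fun y => ?_
    by_cases h : l < f y
    · simp [indicator, h]
    · simp [indicator, h, not_lt.1 h]
  calc _ ≤ (volume (Metric.closedBall x ((2 : ℝ) ^ k)))⁻¹ *
      ((∫⁻ y in Metric.closedBall x ((2 : ℝ) ^ k), {y | l < f y}.indicator f y) +
        l * volume (Metric.closedBall x ((2 : ℝ) ^ k))) := by gcongr
    _ = (volume (Metric.closedBall x ((2 : ℝ) ^ k)))⁻¹ *
      (∫⁻ y in Metric.closedBall x ((2 : ℝ) ^ k), {y | l < f y}.indicator f y) + l := by
        rw [mul_add, mul_comm l, ← mul_assoc, ENNReal.inv_mul_cancel hV0 hVt, one_mul]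
    _ ≤ _ := by
        gcongr
        exact le_iSup (fun k : ℤ => (volume (Metric.closedBall x ((2 : ℝ) ^ k)))⁻¹ *
          ∫⁻ y in Metric.closedBall x ((2 : ℝ) ^ k), {y | l < f y}.indicator f y) k

theorem mul_volume_two_mul_lt_maximalFn_le {n : ℕ} (f : EuclideanSpace ℝ (Fin n) → ℝ≥0∞)
    {l : ℝ≥0∞} (hl : l ≠ ⊤) :
    l * volume {x | 2 * l < maximalFn f x} ≤ 4 ^ n * ∫⁻ y, {y | l < f y}.indicator f y := by
  refine le_trans ?_ (mul_volume_lt_maximalFn_le l)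
  refine mul_le_mul_right (measure_mono fun x hx => ?_) _
  have hx' : 2 * l < maximalFn f x := hx
  have := hx'.trans_le (maximalFn_le_add f l x)
  rw [two_mul] at this
  exact (ENNReal.add_lt_add_iff_right hl).1 this

/-- The layer cake formula for a single extended number. -/
theorem lintegral_Ioi_indicator_rpow {p : ℝ} (hp : 0 < p) (z : ℝ≥0∞) :
    ∫⁻ l in Ioi (0 : ℝ), {l : ℝ | ENNReal.ofReal l < z}.indicator
      (fun l => ENNReal.ofReal (l ^ (p - 1))) l = ENNReal.ofReal (1 / p) * z ^ p := by
  have fin : ∀ r : ℝ, 0 ≤ r → ∫⁻ l in Ioi (0 : ℝ),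
      {l : ℝ | ENNReal.ofReal l < ENNReal.ofReal r}.indicator
        (fun l => ENNReal.ofReal (l ^ (p - 1))) l = ENNReal.ofReal (1 / p) * ENNReal.ofReal r ^ p := by
    intro r hr
    have hms : MeasurableSet {l : ℝ | ENNReal.ofReal l < ENNReal.ofReal r} :=
      measurableSet_lt ENNReal.measurable_ofReal measurable_const
    rw [setLIntegral_indicator hms]
    have : {l : ℝ | ENNReal.ofReal l < ENNReal.ofReal r} ∩ Ioi 0 = Ioo 0 r := by
      ext l
      simp only [mem_inter_iff, mem_ofPred_eq, mem_Ioi, mem_Ioo]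
      constructor
      · rintro ⟨h1, h2⟩
        exact ⟨h2, (ENNReal.ofReal_lt_ofReal_iff_of_nonneg h2.le).1 h1⟩
      · rintro ⟨h1, h2⟩
        exact ⟨(ENNReal.ofReal_lt_ofReal_iff_of_nonneg h1.le).2 h2, h1⟩
    rw [this, ← ofReal_integral_eq_lintegral_ofReal]
    · rw [← integral_Ioc_eq_integral_Ioo, ← intervalIntegral.integral_of_le hr,
        integral_rpow (Or.inl (by linarith)), ENNReal.ofReal_rpow_of_nonneg hr hp.le,
        ← ENNReal.ofReal_mul (by positivity)]
      congr 1
      rw [sub_add_cancel, Real.zero_rpow hp.ne']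
      ring
    · have := (intervalIntegral.intervalIntegrable_rpow' (a := 0) (b := r) (r := p - 1)
        (by linarith)).1
      exact this.mono_set Ioo_subset_Ioc_self
    · refine (ae_restrict_mem measurableSet_Ioo).mono fun l hl => ?_
      exact Real.rpow_nonneg hl.1.le _
  by_cases hz : z = ⊤
  · rw [hz, ENNReal.top_rpow_of_pos hp, ENNReal.mul_top (by simpa using hp)]
    refine ENNReal.eq_top_of_forall_nnreal_le fun N => ?_
    have h := fin ((p * N) ^ (1 / p)) (by positivity)
    rw [ENNReal.ofReal_rpow_of_nonneg (by positivity) hp.le, ← ENNReal.ofReal_mul (by positivity),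
      ← Real.rpow_mul (by positivity)] at h
    have e : 1 / p * (p * (N : ℝ)) ^ (1 / p * p) = N := by
      rw [one_div_mul_cancel hp.ne', Real.rpow_one]
      field_simp
    rw [e, ENNReal.ofReal_coe_nnreal] at h
    rw [← h]
    refine lintegral_mono fun l => ?_
    refine indicator_le_indicator_of_subset (fun l _ => ENNReal.ofReal_lt_top) (fun _ => zero_le) l
  · rw [← ENNReal.ofReal_toReal hz]
    exact fin _ ENNReal.toReal_nonneg

/-- The strong type `(t,t)` inequality for the maximal function, `1 < t < ∞`. -/
theorem lintegral_maximalFn_rpow_le {n : ℕ} {t : ℝ} (ht : 1 < t)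
    {f : EuclideanSpace ℝ (Fin n) → ℝ≥0∞} (hf : Measurable f) :
    ∫⁻ x, maximalFn f x ^ t ≤
      2 ^ t * ENNReal.ofReal (t / (t - 1)) * 4 ^ n * ∫⁻ x, f x ^ t := by
  have ht0 : 0 < t := by linarith
  have ht1 : 0 < t - 1 := by linarith
  have hM := measurable_maximalFn hf
  have meas : ∀ g : EuclideanSpace ℝ (Fin n) → ℝ≥0∞, Measurable g →
      MeasurableSet {z : EuclideanSpace ℝ (Fin n) × ℝ | ENNReal.ofReal z.2 < g z.1} := fun g hg =>
    measurableSet_lt (ENNReal.measurable_ofReal.comp measurable_snd) (hg.comp measurable_fst)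
  have hpow : ∀ s : ℝ, Measurable fun l : ℝ => ENNReal.ofReal (l ^ s) := fun s =>
    ENNReal.measurable_ofReal.comp (measurable_id.pow_const s)
  -- The layer cake formula for `M f / 2`, integrated over the space.
  have h1 : ENNReal.ofReal (1 / t) * ∫⁻ x, (maximalFn f x / 2) ^ t
      = ∫⁻ l in Ioi (0 : ℝ), volume {x | 2 * ENNReal.ofReal l < maximalFn f x} *
          ENNReal.ofReal (l ^ (t - 1)) := by
    rw [← lintegral_const_mul _ ((hM.div_const _).pow_const _)]
    simp_rw [← lintegral_Ioi_indicator_rpow ht0]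
    rw [lintegral_lintegral_swap]
    · refine lintegral_congr fun l => ?_
      have : ∀ x, {l : ℝ | ENNReal.ofReal l < maximalFn f x / 2}.indicator
          (fun l => ENNReal.ofReal (l ^ (t - 1))) l =
          {x | 2 * ENNReal.ofReal l < maximalFn f x}.indicator
            (fun _ => ENNReal.ofReal (l ^ (t - 1))) x := by
        intro x
        simp only [indicator, mem_ofPred_eq]
        congr 1
        rw [ENNReal.lt_div_iff_mul_lt (by simp) (by simp), mul_comm]
      simp_rw [this]
      rw [lintegral_indicator_const (measurableSet_lt measurable_const hM), mul_comm]
    · refine Measurable.aemeasurable ?_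
      exact ((hpow _).comp measurable_snd).indicator (meas _ (hM.div_const 2))
  have h2 : ∫⁻ l in Ioi (0 : ℝ), volume {x | 2 * ENNReal.ofReal l < maximalFn f x} *
          ENNReal.ofReal (l ^ (t - 1)) ≤
      4 ^ n * ∫⁻ l in Ioi (0 : ℝ), ∫⁻ x, f x * {l : ℝ | ENNReal.ofReal l < f x}.indicator
          (fun l => ENNReal.ofReal (l ^ (t - 1 - 1))) l := by
    rw [← lintegral_const_mul']
    · refine setLIntegral_mono' measurableSet_Ioi fun l hl => ?_
      have e : ENNReal.ofReal (l ^ (t - 1)) =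
          ENNReal.ofReal l * ENNReal.ofReal (l ^ (t - 1 - 1)) := by
        rw [← ENNReal.ofReal_mul (le_of_lt hl)]
        congr 1
        conv_rhs => rw [mul_comm, ← Real.rpow_add_one (ne_of_gt hl), sub_add_cancel]
      calc _ = ENNReal.ofReal l * volume {x | 2 * ENNReal.ofReal l < maximalFn f x} *
            ENNReal.ofReal (l ^ (t - 1 - 1)) := by rw [e]; ring
        _ ≤ 4 ^ n * (∫⁻ y, {y | ENNReal.ofReal l < f y}.indicator f y) *
            ENNReal.ofReal (l ^ (t - 1 - 1)) := by
          refine mul_le_mul_left ?_ _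
          exact mul_volume_two_mul_lt_maximalFn_le f ENNReal.ofReal_ne_top
        _ = _ := by
          rw [mul_assoc, ← lintegral_mul_const' _ _ ENNReal.ofReal_ne_top]
          congr 1
          refine lintegral_congr fun x => ?_
          by_cases h : ENNReal.ofReal l < f x <;> simp [indicator, h]
    · simp
  have h3 : ∫⁻ l in Ioi (0 : ℝ), ∫⁻ x, f x * {l : ℝ | ENNReal.ofReal l < f x}.indicator
          (fun l => ENNReal.ofReal (l ^ (t - 1 - 1))) l =
      ENNReal.ofReal (1 / (t - 1)) * ∫⁻ x, f x ^ t := by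
    rw [lintegral_lintegral_swap]
    · rw [← lintegral_const_mul _ (hf.pow_const _)]
      refine lintegral_congr fun x => ?_
      rw [lintegral_const_mul _ ((hpow _).indicator
        (measurableSet_lt ENNReal.measurable_ofReal measurable_const)),
        lintegral_Ioi_indicator_rpow ht1, mul_left_comm]
      congr 1
      nth_rw 1 [← ENNReal.rpow_one (f x)]
      rw [← ENNReal.rpow_add_of_nonneg _ _ (by norm_num) ht1.le]
      congr 1
      ring
    · refine Measurable.aemeasurable ?_
      have := (meas f hf).preimage measurable_swap
      exact (hf.comp measurable_snd).mul (((hpow _).comp measurable_fst).indicator this)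
  have h4 : ∫⁻ x, maximalFn f x ^ t = 2 ^ t * ∫⁻ x, (maximalFn f x / 2) ^ t := by
    rw [← lintegral_const_mul _ ((hM.div_const _).pow_const _)]
    refine lintegral_congr fun x => ?_
    rw [← ENNReal.mul_rpow_of_nonneg _ _ ht0.le, ENNReal.mul_div_cancel (by simp) (by simp)]
  have h5 : ∫⁻ x, (maximalFn f x / 2) ^ t =
      ENNReal.ofReal t * (ENNReal.ofReal (1 / t) * ∫⁻ x, (maximalFn f x / 2) ^ t) := by
    rw [← mul_assoc, ← ENNReal.ofReal_mul ht0.le, mul_one_div_cancel ht0.ne', ENNReal.ofReal_one,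
      one_mul]
  rw [h4, h5, h1]
  calc _ ≤ 2 ^ t * (ENNReal.ofReal t * (4 ^ n *
        (ENNReal.ofReal (1 / (t - 1)) * ∫⁻ x, f x ^ t))) := by
        rw [← h3]
        gcongr
    _ = _ := by
        rw [div_eq_mul_one_div t, ENNReal.ofReal_mul ht0.le]
        ring

/-! ### Riesz potentials and the Hardy-Littlewood-Sobolev inequality -/

/-- The (unnormalised) Riesz potential `∫ f(y) |x - y| ^ (s - n) dy` of a nonnegative function. -/
noncomputable def rieszPotential {n : ℕ} (s : ℝ) (f : EuclideanSpace ℝ (Fin n) → ℝ≥0∞)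
    (x : EuclideanSpace ℝ (Fin n)) : ℝ≥0∞ :=
  ∫⁻ y, f y * ENNReal.ofReal (‖x - y‖ ^ (s - n))

theorem measurable_rieszPotential {n : ℕ} (s : ℝ) {f : EuclideanSpace ℝ (Fin n) → ℝ≥0∞}
    (hf : Measurable f) : Measurable (rieszPotential s f) := by
  refine Measurable.lintegral_prod_right' (f := fun z : EuclideanSpace ℝ (Fin n) ×
    EuclideanSpace ℝ (Fin n) => f z.2 * ENNReal.ofReal (‖z.1 - z.2‖ ^ (s - n))) ?_
  fun_prop

theorem rieszPotential_congr_ae {n : ℕ} (s : ℝ) {f g : EuclideanSpace ℝ (Fin n) → ℝ≥0∞}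
    (h : f =ᵐ[volume] g) : rieszPotential s f = rieszPotential s g := by
  funext x
  exact lintegral_congr_ae (h.mono fun y hy => by simp only [hy])

theorem tsum_ofReal_mul_geometric {A q : ℝ} (hA : 0 ≤ A) (hq : 0 ≤ q) (hq1 : q < 1) :
    ∑' m : ℕ, ENNReal.ofReal (A * q ^ m) = ENNReal.ofReal (A * (1 - q)⁻¹) := by
  rw [← ENNReal.ofReal_tsum_of_nonneg (fun m => by positivity)
    ((summable_geometric_of_lt_one hq hq1).mul_left A), tsum_mul_left,
    tsum_geometric_of_lt_one hq hq1]

theorem lintegral_closedBall_le_eLpNorm' {n : ℕ} {t : ℝ} (ht : 1 < t)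
    {f : EuclideanSpace ℝ (Fin n) → ℝ≥0∞} (hf : Measurable f) (x : EuclideanSpace ℝ (Fin n))
    {r : ℝ} (hr : 0 < r) :
    ∫⁻ y in Metric.closedBall x r, f y ≤ ENNReal.ofReal (r ^ (n - n / t)) *
      volume (Metric.ball (0 : EuclideanSpace ℝ (Fin n)) 1) ^ (1 - 1 / t) *
        eLpNorm' f t volume := by
  have h := eLpNorm'_le_eLpNorm'_mul_rpow_measure_univ (p := 1) (q := t) one_pos ht.le
    (μ := volume.restrict (Metric.closedBall x r)) (f := f) hf.aestronglyMeasurable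
  have ht0 : 0 < 1 - 1 / t := by
    rw [sub_pos, div_lt_one (by linarith)]
    exact ht
  have ht00 : 0 ≤ t := by linarith
  rw [eLpNorm'_eq_lintegral_enorm] at h
  simp only [enorm_eq_self, ENNReal.rpow_one, div_one, Measure.restrict_apply_univ] at h
  rw [volume_closedBall_euclidean x hr.le, ENNReal.mul_rpow_of_nonneg _ _ ht0.le,
    ENNReal.ofReal_rpow_of_nonneg (by positivity) ht0.le, ← Real.rpow_natCast r n,
    ← Real.rpow_mul hr.le, mul_one_sub, mul_one_div] at h
  refine h.trans ?_
  rw [mul_comm]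
  exact mul_le_mul_right (eLpNorm'_mono_measure f Measure.restrict_le_self ht00) _

/-- The potential is dominated by a sum over dyadic annuli of radii `2 ^ k * δ`, `k ∈ ℤ`, here split
into the nonnegative and the negative `k`. -/
theorem rieszPotential_le_tsum {n : ℕ} {s : ℝ} (hsn : s < n)
    {f : EuclideanSpace ℝ (Fin n) → ℝ≥0∞} (hf : Measurable f) (x : EuclideanSpace ℝ (Fin n))
    {δ : ℝ} (hδ : 0 < δ) :
    rieszPotential s f x ≤
      (∑' m : ℕ, ENNReal.ofReal ((2 ^ m * δ) ^ (s - n)) *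
        ∫⁻ y in Metric.closedBall x (2 * (2 ^ m * δ)), f y) +
      ∑' m : ℕ, ENNReal.ofReal (((1 / 2) ^ (m + 1) * δ) ^ (s - n)) *
        ∫⁻ y in Metric.closedBall x (2 * ((1 / 2) ^ (m + 1) * δ)), f y := by
  have hm : ∀ r, MeasurableSet (Metric.closedBall x r) := fun r =>
    Metric.isClosed_closedBall.measurableSet
  simp_rw [← lintegral_indicator (hm _), ← lintegral_const_mul _ (hf.indicator (hm _))]
  have hmeas : ∀ (c : ℝ≥0∞) (r : ℝ), Measurable fun y =>
      c * (Metric.closedBall x r).indicator f y :=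
    fun c r => (hf.indicator (hm _)).const_mul _
  rw [← lintegral_tsum fun m => (hmeas _ _).aemeasurable,
    ← lintegral_tsum fun m => (hmeas _ _).aemeasurable,
    ← lintegral_add_left (Measurable.tsum fun m => hmeas _ _)]
  refine lintegral_mono fun y => ?_
  rcases eq_or_ne x y with rfl | hxy
  · rw [sub_self, norm_zero, Real.zero_rpow (by linarith), ENNReal.ofReal_zero, mul_zero]
    exact zero_le
  have hpos : 0 < ‖x - y‖ := norm_pos_iff.2 (sub_ne_zero.2 hxy)
  have term : ∀ ρ : ℝ, 0 < ρ → ρ < ‖x - y‖ → ‖x - y‖ ≤ 2 * ρ →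
      f y * ENNReal.ofReal (‖x - y‖ ^ (s - n)) ≤
        ENNReal.ofReal (ρ ^ (s - n)) * (Metric.closedBall x (2 * ρ)).indicator f y := by
    intro ρ hρ h1 h2
    rw [indicator_of_mem, mul_comm]
    · gcongr ENNReal.ofReal ?_ * _
      exact Real.rpow_le_rpow_of_nonpos hρ h1.le (by linarith)
    · rwa [Metric.mem_closedBall, dist_comm, dist_eq_norm]
  obtain ⟨k, hk1, hk2⟩ := exists_mem_Ioc_zpow (x := ‖x - y‖ / δ) (y := (2 : ℝ)) (by positivity)
    (by norm_num)
  rw [lt_div_iff₀ hδ] at hk1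
  rw [div_le_iff₀ hδ, zpow_add_one₀ (by norm_num)] at hk2
  have h := term (2 ^ k * δ) (by positivity) hk1 (by linarith)
  rcases k with m | m
  · simp only [Int.ofNat_eq_natCast, zpow_natCast] at h
    refine h.trans (le_trans ?_ le_self_add)
    exact ENNReal.le_tsum (f := fun m : ℕ => ENNReal.ofReal ((2 ^ m * δ) ^ (s - n)) *
      (Metric.closedBall x (2 * (2 ^ m * δ))).indicator f y) m
  · rw [zpow_negSucc, ← inv_pow, ← one_div] at h
    refine h.trans (le_trans ?_ le_add_self)
    exact ENNReal.le_tsum (f := fun m : ℕ => ENNReal.ofReal (((1 / 2) ^ (m + 1) * δ) ^ (s - n)) *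
      (Metric.closedBall x (2 * ((1 / 2) ^ (m + 1) * δ))).indicator f y) m

/-- The annuli of radius below `δ` are summed with the maximal function, those of radius above `δ`
with Hölder's inequality; both are geometric series. -/
theorem rieszPotential_le_add {n : ℕ} {s t : ℝ} (hs : 0 < s) (ht : 1 < t) (hst : s * t < n) :
    ∃ C : ℝ≥0∞, C ≠ ⊤ ∧ ∀ f : EuclideanSpace ℝ (Fin n) → ℝ≥0∞, Measurable f → ∀ x, ∀ δ : ℝ, 0 < δ →
      rieszPotential s f x ≤ C * (ENNReal.ofReal (δ ^ s) * maximalFn f x +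
        ENNReal.ofReal (δ ^ (s - n / t)) * eLpNorm' f t volume) := by
  have ht0 : 0 < t := by linarith
  have hsn : s < n := by nlinarith
  have hsnt : s - n / t < 0 := by
    rw [sub_neg, lt_div_iff₀ ht0]
    exact hst
  set V := volume (Metric.ball (0 : EuclideanSpace ℝ (Fin n)) 1) with hV
  have hVt : V ≠ ⊤ := measure_ball_lt_top.ne
  set q1 : ℝ := 2 ^ (s - n / t) with hq1
  set q2 : ℝ := (1 / 2) ^ s with hq2
  have hq1l : q1 < 1 := Real.rpow_lt_one_of_one_lt_of_neg (by norm_num) hsnt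
  have hq2l : q2 < 1 := Real.rpow_lt_one (by norm_num) (by norm_num) hs
  have hq10 : 0 < q1 := by positivity
  have hq20 : 0 < q2 := by positivity
  set C1 : ℝ≥0∞ := ENNReal.ofReal (2 ^ (n - n / t) * (1 - q1)⁻¹) * V ^ (1 - 1 / t) with hC1
  set C2 : ℝ≥0∞ := ENNReal.ofReal (4 ^ n * (1 - q2)⁻¹) * V with hC2
  have h1t : 0 ≤ 1 - 1 / t := by
    rw [sub_nonneg, div_le_one ht0]
    exact ht.le
  refine ⟨C1 + C2, ENNReal.add_ne_top.2 ⟨ENNReal.mul_ne_top ENNReal.ofReal_ne_top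
    (ENNReal.rpow_ne_top_of_nonneg h1t hVt), ENNReal.mul_ne_top ENNReal.ofReal_ne_top hVt⟩, ?_⟩
  intro f hf x δ hδ
  have far : ∑' m : ℕ, ENNReal.ofReal ((2 ^ m * δ) ^ (s - n)) *
        ∫⁻ y in Metric.closedBall x (2 * (2 ^ m * δ)), f y ≤
      C1 * (ENNReal.ofReal (δ ^ (s - n / t)) * eLpNorm' f t volume) := by
    calc _ ≤ ∑' m : ℕ, ENNReal.ofReal (2 ^ (n - n / t) * δ ^ (s - n / t) * q1 ^ m) *
          (V ^ (1 - 1 / t) * eLpNorm' f t volume) := by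
          refine ENNReal.tsum_le_tsum fun m => ?_
          have hρ : (0 : ℝ) < 2 ^ m * δ := by positivity
          have e : (2 ^ m * δ) ^ (s - n) * (2 * (2 ^ m * δ)) ^ ((n : ℝ) - n / t) =
              2 ^ (n - n / t) * δ ^ (s - n / t) * q1 ^ m := by
            have e' : (s - n) + ((n : ℝ) - n / t) = s - n / t := by ring
            rw [Real.mul_rpow (by norm_num) hρ.le, mul_left_comm, ← Real.rpow_add hρ, e',
              Real.mul_rpow (by positivity) hδ.le, hq1, ← Real.rpow_natCast, ← Real.rpow_natCast,
              ← Real.rpow_mul (by norm_num), ← Real.rpow_mul (by norm_num), mul_comm (m : ℝ)]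
            ring
          calc _ ≤ ENNReal.ofReal ((2 ^ m * δ) ^ (s - n)) *
              (ENNReal.ofReal ((2 * (2 ^ m * δ)) ^ ((n : ℝ) - n / t)) * V ^ (1 - 1 / t) *
                eLpNorm' f t volume) := by
                gcongr
                exact lintegral_closedBall_le_eLpNorm' ht hf x (by positivity)
            _ = _ := by
                rw [← e, ENNReal.ofReal_mul (by positivity)]
                ring
      _ = _ := by
          rw [ENNReal.tsum_mul_right, tsum_ofReal_mul_geometric (by positivity) hq10.le hq1l, hC1,
            mul_right_comm, ENNReal.ofReal_mul
              (mul_nonneg (by positivity) (inv_nonneg.2 (by linarith)))]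
          ring
  have near : ∑' m : ℕ, ENNReal.ofReal (((1 / 2) ^ (m + 1) * δ) ^ (s - n)) *
        ∫⁻ y in Metric.closedBall x (2 * ((1 / 2) ^ (m + 1) * δ)), f y ≤
      C2 * (ENNReal.ofReal (δ ^ s) * maximalFn f x) := by
    calc _ ≤ ∑' m : ℕ, ENNReal.ofReal (4 ^ n * δ ^ s * q2 ^ m) * (V * maximalFn f x) := by
          refine ENNReal.tsum_le_tsum fun m => ?_
          have hρ : (0 : ℝ) < (1 / 2) ^ (m + 1) * δ := by positivity
          have e : ((1 / 2) ^ (m + 1) * δ) ^ (s - n) * (2 * (2 * ((1 / 2) ^ (m + 1) * δ))) ^ n ≤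
              4 ^ n * δ ^ s * q2 ^ m := by
            have : ((1 / 2) ^ (m + 1) * δ) ^ (s - n) * (2 * (2 * ((1 / 2) ^ (m + 1) * δ))) ^ n =
                4 ^ n * δ ^ s * q2 ^ (m + 1) := by
              rw [show 2 * (2 * ((1 / 2) ^ (m + 1) * δ)) = 4 * ((1 / 2) ^ (m + 1) * δ) by ring,
                mul_pow 4, mul_left_comm, ← Real.rpow_natCast (_ * δ), ← Real.rpow_add hρ,
                sub_add_cancel, Real.mul_rpow (by positivity) hδ.le, hq2,
                ← Real.rpow_natCast _ (m + 1), ← Real.rpow_natCast _ (m + 1),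
                ← Real.rpow_mul (by norm_num), ← Real.rpow_mul (by norm_num), mul_comm s]
              ring
            rw [this]
            refine mul_le_mul_of_nonneg_left ?_ (by positivity)
            exact pow_le_pow_of_le_one hq20.le hq2l.le (Nat.le_succ m)
          calc _ ≤ ENNReal.ofReal (((1 / 2) ^ (m + 1) * δ) ^ (s - n)) *
              (ENNReal.ofReal ((2 * (2 * ((1 / 2) ^ (m + 1) * δ))) ^ n) * V * maximalFn f x) := by
                gcongr
                exact lintegral_closedBall_le_maximalFn f x (by positivity)
            _ = ENNReal.ofReal (((1 / 2) ^ (m + 1) * δ) ^ (s - n) *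
                  (2 * (2 * ((1 / 2) ^ (m + 1) * δ))) ^ n) * (V * maximalFn f x) := by
                rw [ENNReal.ofReal_mul (by positivity)]
                ring
            _ ≤ _ := by gcongr
      _ = _ := by
          rw [ENNReal.tsum_mul_right, tsum_ofReal_mul_geometric (by positivity) hq20.le hq2l, hC2,
            mul_right_comm, ENNReal.ofReal_mul
              (mul_nonneg (by positivity) (inv_nonneg.2 (by linarith)))]
          ring
  calc rieszPotential s f x ≤ _ := rieszPotential_le_tsum hsn hf x hδ
    _ ≤ C1 * (ENNReal.ofReal (δ ^ (s - n / t)) * eLpNorm' f t volume) +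
        C2 * (ENNReal.ofReal (δ ^ s) * maximalFn f x) := add_le_add far near
    _ ≤ _ := by
        rw [mul_add, add_comm]
        exact add_le_add (mul_le_mul_left le_add_self _) (mul_le_mul_left le_self_add _)

theorem maximalFn_ne_zero {n : ℕ} {f : EuclideanSpace ℝ (Fin n) → ℝ≥0∞}
    (h : ∫⁻ y, f y ≠ 0) (x : EuclideanSpace ℝ (Fin n)) : maximalFn f x ≠ 0 := by
  intro h0
  refine h ?_
  have hz : ∀ m : ℕ, ∫⁻ y in Metric.closedBall x (m + 1 : ℝ), f y = 0 := fun m => by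
    have := lintegral_closedBall_le_maximalFn f x (r := m + 1) (by positivity)
    rwa [h0, mul_zero, nonpos_iff_eq_zero] at this
  have hU : ⋃ m : ℕ, Metric.closedBall x (m + 1 : ℝ) = univ := by
    refine eq_univ_of_forall fun y => mem_iUnion.2 ?_
    obtain ⟨m, hm⟩ := exists_nat_ge (dist y x)
    exact ⟨m, Metric.mem_closedBall.2 (by linarith)⟩
  rw [← setLIntegral_univ, ← hU]
  refine le_antisymm ((lintegral_iUnion_le _ _).trans ?_) zero_le
  simp [hz]

/-- Hedberg's pointwise inequality. -/
theorem rieszPotential_le_maximalFn {n : ℕ} {s t : ℝ} (hs : 0 < s) (ht : 1 < t) (hst : s * t < n) :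
    ∃ C : ℝ≥0∞, C ≠ ⊤ ∧ ∀ f : EuclideanSpace ℝ (Fin n) → ℝ≥0∞, Measurable f →
      eLpNorm' f t volume ≠ ⊤ → ∀ x, rieszPotential s f x ≤
        C * (eLpNorm' f t volume ^ (s * t / n) * maximalFn f x ^ (1 - s * t / n)) := by
  obtain ⟨C, hC, h⟩ := rieszPotential_le_add hs ht hst
  have ht0 : 0 < t := by linarith
  have hn : (0 : ℝ) < n := lt_trans (by positivity) hst
  have hθ0 : 0 < s * t / n := by positivity
  have hθ1 : 0 < 1 - s * t / n := by
    rw [sub_pos, div_lt_one hn]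
    exact hst
  refine ⟨2 * (C + 1), ENNReal.mul_ne_top (by simp) (by simpa using hC), fun f hf hF x => ?_⟩
  set F := eLpNorm' f t volume with hFdef
  by_cases hint : ∫⁻ y, f y = 0
  · have hf0 : f =ᵐ[volume] 0 := (lintegral_eq_zero_iff hf).1 hint
    have : rieszPotential s f x = 0 := by
      rw [rieszPotential_congr_ae s hf0]
      simp [rieszPotential]
    rw [this]
    exact zero_le
  have hF0 : F ≠ 0 := by
    intro h0
    refine hint ?_
    rw [hFdef, eLpNorm'_eq_zero_iff ht0 hf.aestronglyMeasurable] at h0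
    exact (lintegral_eq_zero_iff hf).2 h0
  have hM0 : maximalFn f x ≠ 0 := maximalFn_ne_zero hint x
  by_cases hMt : maximalFn f x = ⊤
  · rw [hMt, ENNReal.top_rpow_of_pos hθ1, ENNReal.mul_top, ENNReal.mul_top]
    · exact le_top
    · simp
    · exact (ENNReal.rpow_pos (pos_iff_ne_zero.2 hF0) hF).ne'
  obtain ⟨a, ha⟩ : ∃ a : ℝ, F = ENNReal.ofReal a := ⟨_, (ENNReal.ofReal_toReal hF).symm⟩
  obtain ⟨b, hb⟩ : ∃ b : ℝ, maximalFn f x = ENNReal.ofReal b :=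
    ⟨_, (ENNReal.ofReal_toReal hMt).symm⟩
  have ha0 : 0 < a := by
    rw [ha] at hF0
    exact ENNReal.ofReal_pos.1 (pos_iff_ne_zero.2 hF0)
  have hb0 : 0 < b := by
    rw [hb] at hM0
    exact ENNReal.ofReal_pos.1 (pos_iff_ne_zero.2 hM0)
  -- This choice of `δ` makes the bounds for the near and for the far part equal.
  have hδ : 0 < (a / b) ^ (t / n) := by positivity
  refine ((h f hf x _ hδ).trans (mul_le_mul_left (le_self_add (b := 1)) _)).trans_eq ?_
  rw [← hFdef, ha, hb, ENNReal.ofReal_rpow_of_pos ha0, ENNReal.ofReal_rpow_of_pos hb0,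
    ← ENNReal.ofReal_mul (by positivity), ← ENNReal.ofReal_mul (by positivity),
    ← ENNReal.ofReal_mul (by positivity)]
  have e1 : ((a / b) ^ (t / n)) ^ s * b = a ^ (s * t / n) * b ^ (1 - s * t / n) := by
    rw [← Real.rpow_mul (by positivity), Real.div_rpow ha0.le hb0.le, Real.rpow_sub hb0,
      Real.rpow_one, show t / n * s = s * t / n by ring]
    ring
  have e2 : ((a / b) ^ (t / n)) ^ (s - n / t) * a = a ^ (s * t / n) * b ^ (1 - s * t / n) := by
    rw [← Real.rpow_mul (by positivity),
      show t / n * (s - n / t) = s * t / n - 1 by field_simp,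
      Real.div_rpow ha0.le hb0.le, Real.rpow_sub ha0, Real.rpow_sub hb0, Real.rpow_sub hb0]
    simp only [Real.rpow_one]
    have := Real.rpow_pos_of_pos hb0 (s * t / n)
    field_simp
  rw [e1, e2, ← two_mul, mul_left_comm, mul_assoc]

/-- The Hardy-Littlewood-Sobolev inequality. -/
theorem eLpNorm'_rieszPotential_le {n : ℕ} {s t : ℝ} (hs : 0 < s) (ht : 1 < t) (hst : s * t < n) :
    ∃ C : ℝ≥0∞, C ≠ ⊤ ∧ ∀ f : EuclideanSpace ℝ (Fin n) → ℝ≥0∞, Measurable f →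
      eLpNorm' (rieszPotential s f) (n * t / (n - s * t)) volume ≤ C * eLpNorm' f t volume := by
  obtain ⟨C, hC, h⟩ := rieszPotential_le_maximalFn hs ht hst
  have ht0 : 0 < t := by linarith
  have hn : (0 : ℝ) < n := lt_trans (by positivity) hst
  have hd : 0 < n - s * t := by linarith
  set r : ℝ := n * t / (n - s * t) with hr
  have hr0 : 0 < r := by positivity
  set D : ℝ≥0∞ := 2 ^ t * ENNReal.ofReal (t / (t - 1)) * 4 ^ n with hD
  have hDt : D ≠ ⊤ := ENNReal.mul_ne_top (ENNReal.mul_ne_top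
    (ENNReal.rpow_ne_top_of_nonneg ht0.le (by simp)) ENNReal.ofReal_ne_top) (by simp)
  have hD0 : D ≠ 0 := by
    refine mul_ne_zero (mul_ne_zero ?_ ?_) (by simp)
    · exact (ENNReal.rpow_pos (by simp) (by simp)).ne'
    · rw [Ne, ENNReal.ofReal_eq_zero, not_le]
      exact div_pos ht0 (by linarith)
  refine ⟨(C + 1) * D ^ (1 / r), ENNReal.mul_ne_top (by simpa using hC)
    (ENNReal.rpow_ne_top_of_nonneg (by positivity) hDt), fun f hf => ?_⟩
  set F := eLpNorm' f t volume with hF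
  by_cases hFt : F = ⊤
  · rw [hFt, ENNReal.mul_top]
    · exact le_top
    · exact mul_ne_zero (by simp) (ENNReal.rpow_pos (pos_iff_ne_zero.2 hD0) hDt).ne'
  have hFpow : ∫⁻ y, f y ^ t = F ^ t := by
    rw [hF, eLpNorm'_eq_lintegral_enorm, ← ENNReal.rpow_mul, one_div_mul_cancel ht0.ne',
      ENNReal.rpow_one]
    simp
  rw [eLpNorm'_eq_lintegral_enorm]
  simp only [enorm_eq_self]
  have hexp : (1 - s * t / n) * r = t := by
    rw [hr]
    field_simp
  have key : ∫⁻ x, rieszPotential s f x ^ r ≤ ((C + 1) * D ^ (1 / r) * F) ^ r := by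
    calc ∫⁻ x, rieszPotential s f x ^ r
        ≤ ∫⁻ x, (C * F ^ (s * t / n)) ^ r * maximalFn f x ^ t := by
          refine lintegral_mono fun x => ?_
          refine (ENNReal.rpow_le_rpow (h f hf hFt x) hr0.le).trans_eq ?_
          rw [← mul_assoc, ENNReal.mul_rpow_of_nonneg _ _ hr0.le, ← ENNReal.rpow_mul _ _ r, hexp]
      _ ≤ (C * F ^ (s * t / n)) ^ r * (D * F ^ t) := by
          rw [lintegral_const_mul _ ((measurable_maximalFn hf).pow_const _), ← hFpow]
          gcongr
          exact lintegral_maximalFn_rpow_le ht hf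
      _ = C ^ r * D * F ^ r := by
          rw [ENNReal.mul_rpow_of_nonneg _ _ hr0.le, ← ENNReal.rpow_mul]
          have : F ^ r = F ^ (s * t / n * r) * F ^ t := by
            rw [← ENNReal.rpow_add_of_nonneg _ _ (by positivity) ht0.le]
            congr 1
            nlinarith
          rw [this]
          ring
      _ ≤ (C + 1) ^ r * D * F ^ r := by
          gcongr
          exact le_self_add
      _ = _ := by
          rw [ENNReal.mul_rpow_of_nonneg _ _ hr0.le, ENNReal.mul_rpow_of_nonneg _ _ hr0.le,
            ← ENNReal.rpow_mul, one_div_mul_cancel hr0.ne', ENNReal.rpow_one]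
  calc _ ≤ (((C + 1) * D ^ (1 / r) * F) ^ r) ^ (1 / r) := by gcongr
    _ = _ := by
        rw [← ENNReal.rpow_mul, mul_one_div_cancel hr0.ne', ENNReal.rpow_one]

/-! ### Riesz potentials on balls -/

/-- Normalised Lebesgue measure on the ball `B(x₀,R)`; the `L^r` norms with respect to it are the
averaged ones. -/
noncomputable def ballMeasure {n : ℕ} (x₀ : EuclideanSpace ℝ (Fin n)) (R : ℝ) :
    Measure (EuclideanSpace ℝ (Fin n)) :=
  (volume (Metric.ball x₀ R))⁻¹ • volume.restrict (Metric.ball x₀ R)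

theorem isProbabilityMeasure_ballMeasure {n : ℕ} (x₀ : EuclideanSpace ℝ (Fin n)) {R : ℝ}
    (hR : 0 < R) : IsProbabilityMeasure (ballMeasure x₀ R) := by
  refine ⟨?_⟩
  rw [ballMeasure, Measure.smul_apply, Measure.restrict_apply_univ, smul_eq_mul]
  exact ENNReal.inv_mul_cancel (Metric.measure_ball_pos _ _ hR).ne' measure_ball_lt_top.ne

theorem ae_ballMeasure_iff {n : ℕ} {x₀ : EuclideanSpace ℝ (Fin n)} {R : ℝ}
    {P : EuclideanSpace ℝ (Fin n) → Prop} :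
    (∀ᵐ x ∂(ballMeasure x₀ R), P x) ↔ ∀ᵐ x ∂(volume.restrict (Metric.ball x₀ R)), P x := by
  rw [ballMeasure, ae_iff, ae_iff, Measure.smul_apply, smul_eq_mul, mul_eq_zero,
    or_iff_right (ENNReal.inv_ne_zero.2 measure_ball_lt_top.ne)]

theorem aestronglyMeasurable_ballMeasure {n : ℕ} {x₀ : EuclideanSpace ℝ (Fin n)} {R : ℝ}
    {f : EuclideanSpace ℝ (Fin n) → ℝ≥0∞}
    (hf : AEMeasurable f (volume.restrict (Metric.ball x₀ R))) :
    AEStronglyMeasurable f (ballMeasure x₀ R) :=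
  (hf.smul_measure _).aestronglyMeasurable

theorem eLpNorm'_const_mul {n : ℕ} {μ : Measure (EuclideanSpace ℝ (Fin n))} {r : ℝ}
    (hr : 0 < r) {f : EuclideanSpace ℝ (Fin n) → ℝ≥0∞} {c : ℝ≥0∞} (hc : c ≠ ⊤) :
    eLpNorm' (fun x => c * f x) r μ = c * eLpNorm' f r μ := by
  rw [eLpNorm'_eq_lintegral_enorm, eLpNorm'_eq_lintegral_enorm]
  simp only [enorm_eq_self, ENNReal.mul_rpow_of_nonneg _ _ hr.le]
  rw [lintegral_const_mul' _ _ (ENNReal.rpow_ne_top_of_nonneg hr.le hc),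
    ENNReal.mul_rpow_of_nonneg _ _ (by positivity), ← ENNReal.rpow_mul,
    mul_one_div_cancel hr.ne', ENNReal.rpow_one]

/-- On a ball of radius `R` all distances are at most `2 R`, so lowering the order of a potential
costs a power of `R`. -/
theorem rieszPotential_ball_le {n : ℕ} {s s' : ℝ} (hs : s' ≤ s) (hn : n ≠ 0)
    {x₀ x : EuclideanSpace ℝ (Fin n)} {R : ℝ} (hx : x ∈ Metric.ball x₀ R)
    (f : EuclideanSpace ℝ (Fin n) → ℝ≥0∞) :
    rieszPotential s ((Metric.ball x₀ R).indicator f) x ≤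
      ENNReal.ofReal ((2 * R) ^ (s - s')) *
        rieszPotential s' ((Metric.ball x₀ R).indicator f) x := by
  have : NeZero n := ⟨hn⟩
  have hne : ∀ᵐ y ∂(volume : Measure (EuclideanSpace ℝ (Fin n))), y ≠ x :=
    compl_mem_ae_iff.2 (measure_singleton x)
  rw [rieszPotential, rieszPotential, ← lintegral_const_mul' _ _ ENNReal.ofReal_ne_top]
  refine lintegral_mono_ae (hne.mono fun y hy => ?_)
  by_cases hyB : y ∈ Metric.ball x₀ R
  · have hpos : 0 < ‖x - y‖ := norm_pos_iff.2 (sub_ne_zero.2 hy.symm)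
    have hle : ‖x - y‖ ≤ 2 * R := by
      rw [← dist_eq_norm]
      have := dist_triangle_right x y x₀
      rw [Metric.mem_ball] at hx hyB
      linarith
    have hR : 0 ≤ 2 * R := hpos.le.trans hle
    rw [mul_left_comm, ← ENNReal.ofReal_mul (Real.rpow_nonneg hR _)]
    refine mul_le_mul_right (ENNReal.ofReal_le_ofReal ?_) _
    rw [show s - n = (s - s') + (s' - n) by ring, Real.rpow_add hpos]
    gcongr
  · simp [hyB]

/-- Averaged `L^t → L^r` bound for Riesz potentials on balls. Exponents below the critical Sobolev
exponent, and potentials of order `s ≥ n / t`, are reduced to the Hardy-Littlewood-Sobolev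
inequality by lowering `s`. -/
theorem eLpNorm'_ballMeasure_rieszPotential_le {n : ℕ} (hn : n ≠ 0) {s t r : ℝ} (hs : 0 < s)
    (ht : 1 < t) (hr : 1 ≤ r) (h : 1 / t - s / n ≤ 1 / r) :
    ∃ C : ℝ≥0∞, C ≠ ⊤ ∧ ∀ (x₀ : EuclideanSpace ℝ (Fin n)) (R : ℝ), 0 < R →
      ∀ f : EuclideanSpace ℝ (Fin n) → ℝ≥0∞,
        AEMeasurable f (volume.restrict (Metric.ball x₀ R)) →
        eLpNorm' (rieszPotential s ((Metric.ball x₀ R).indicator f)) r (ballMeasure x₀ R) ≤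
          C * ENNReal.ofReal (R ^ s) * eLpNorm' f t (ballMeasure x₀ R) := by
  have ht0 : 0 < t := by linarith
  have hr0 : 0 < r := by linarith
  have hn0 : (0 : ℝ) < n := by exact_mod_cast Nat.pos_of_ne_zero hn
  obtain ⟨s', hs'0, hs's, hs't, hs'r⟩ : ∃ s' : ℝ, 0 < s' ∧ s' ≤ s ∧ s' * t < n ∧
      1 / t - s' / n ≤ 1 / r := by
    rcases lt_or_ge (s * t) n with hst | hst
    · exact ⟨s, hs, le_rfl, hst, h⟩
    · set m := min (1 / r) (1 / (2 * t)) with hm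
      have hm0 : 0 < m := lt_min (by positivity) (by positivity)
      have hmt : m ≤ 1 / (2 * t) := min_le_right _ _
      have h2 : 1 / (2 * t) = 1 / t / 2 := by field_simp
      have h1 : 0 < 1 / t := by positivity
      refine ⟨n * (1 / t - m), mul_pos hn0 (by linarith), ?_, ?_, ?_⟩
      · have : (n : ℝ) * (1 / t) ≤ s := by
          rw [mul_one_div, div_le_iff₀ ht0]
          exact hst
        nlinarith
      · have : (n : ℝ) * (1 / t - m) * t = n - n * m * t := by field_simp
        rw [this]
        have : 0 < n * m * t := by positivity
        linarith
      · rw [mul_div_cancel_left₀ _ hn0.ne', sub_sub_cancel]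
        exact min_le_left _ _
  obtain ⟨C, hC, hHLS⟩ := eLpNorm'_rieszPotential_le hs'0 ht hs't
  set r' : ℝ := n * t / (n - s' * t) with hr'
  have hd : 0 < n - s' * t := by linarith
  have hr'0 : 0 < r' := by positivity
  have hinv : 1 / r' = 1 / t - s' / n := by
    rw [hr']
    field_simp
  have hrr' : r ≤ r' := by
    rw [← one_div_le_one_div hr'0 hr0, hinv]
    exact hs'r
  set V := volume (Metric.ball (0 : EuclideanSpace ℝ (Fin n)) 1) with hV
  have hVt : V ≠ ⊤ := measure_ball_lt_top.ne
  have hs'n : 0 < s' / n := by positivity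
  refine ⟨ENNReal.ofReal (2 ^ (s - s')) * C * V ^ (s' / n),
    ENNReal.mul_ne_top (ENNReal.mul_ne_top ENNReal.ofReal_ne_top hC)
      (ENNReal.rpow_ne_top_of_nonneg hs'n.le hVt), ?_⟩
  intro x₀ R hR f hf
  have hprob := isProbabilityMeasure_ballMeasure x₀ hR
  obtain ⟨g, hg, hfg⟩ := hf
  have hB : MeasurableSet (Metric.ball x₀ R) := Metric.isOpen_ball.measurableSet
  have hind : (Metric.ball x₀ R).indicator f =ᵐ[volume] (Metric.ball x₀ R).indicator g :=
    (ae_eq_restrict_iff_indicator_ae_eq hB).1 hfg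
  set VB := volume (Metric.ball x₀ R) with hVB
  have hVB0 : VB ≠ 0 := (Metric.measure_ball_pos _ _ hR).ne'
  have hVBt : VB ≠ ⊤ := measure_ball_lt_top.ne
  have hVBV : VB = ENNReal.ofReal (R ^ n) * V := by
    rw [hVB, Measure.addHaar_ball_of_pos _ _ hR, finrank_euclideanSpace_fin]
  rw [rieszPotential_congr_ae s hind]
  have hft : eLpNorm' f t (ballMeasure x₀ R) =
      VB⁻¹ ^ (1 / t) * eLpNorm' ((Metric.ball x₀ R).indicator g) t volume := by
    rw [ballMeasure, eLpNorm'_smul_measure ht0.le, eLpNorm'_congr_ae hfg,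
      eLpNorm'_eq_lintegral_enorm, eLpNorm'_eq_lintegral_enorm, ← lintegral_indicator hB]
    congr 3
    funext x
    by_cases hx : x ∈ Metric.ball x₀ R <;> simp [hx, ht0]
  have hgm : Measurable ((Metric.ball x₀ R).indicator g) := hg.indicator hB
  have hpow : VB⁻¹ ^ (1 / r') = VB ^ (s' / n) * VB⁻¹ ^ (1 / t) := by
    rw [ENNReal.inv_rpow, ENNReal.inv_rpow, ← ENNReal.rpow_neg, ← ENNReal.rpow_neg,
      ← ENNReal.rpow_add _ _ hVB0 hVBt, hinv]
    congr 1
    ring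
  have hconst : ENNReal.ofReal ((2 * R) ^ (s - s')) * VB ^ (s' / n) =
      ENNReal.ofReal (2 ^ (s - s')) * V ^ (s' / n) * ENNReal.ofReal (R ^ s) := by
    rw [hVBV, ENNReal.mul_rpow_of_nonneg _ _ hs'n.le, ENNReal.ofReal_rpow_of_pos (by positivity),
      ← Real.rpow_natCast, ← Real.rpow_mul hR.le, mul_div_cancel₀ _ hn0.ne',
      Real.mul_rpow (by norm_num) hR.le, ENNReal.ofReal_mul (by positivity),
      show R ^ s = R ^ (s - s') * R ^ s' by rw [← Real.rpow_add hR, sub_add_cancel],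
      ENNReal.ofReal_mul (by positivity)]
    ring
  calc eLpNorm' (rieszPotential s ((Metric.ball x₀ R).indicator g)) r (ballMeasure x₀ R)
      ≤ ENNReal.ofReal ((2 * R) ^ (s - s')) *
        eLpNorm' (rieszPotential s' ((Metric.ball x₀ R).indicator g)) r (ballMeasure x₀ R) := by
        rw [← eLpNorm'_const_mul hr0 ENNReal.ofReal_ne_top]
        refine eLpNorm'_mono_enorm_ae hr0.le (ae_ballMeasure_iff.2 ?_)
        exact (ae_restrict_mem hB).mono fun x hx => rieszPotential_ball_le hs's hn hx g
    _ ≤ ENNReal.ofReal ((2 * R) ^ (s - s')) *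
        eLpNorm' (rieszPotential s' ((Metric.ball x₀ R).indicator g)) r' (ballMeasure x₀ R) := by
        gcongr
        exact eLpNorm'_le_eLpNorm'_of_exponent_le hr0 hrr' _
          (measurable_rieszPotential s' hgm).aestronglyMeasurable
    _ ≤ ENNReal.ofReal ((2 * R) ^ (s - s')) * (VB⁻¹ ^ (1 / r') *
        (C * eLpNorm' ((Metric.ball x₀ R).indicator g) t volume)) := by
        rw [ballMeasure, eLpNorm'_smul_measure hr'0.le]
        refine mul_le_mul_right (mul_le_mul_right ?_ _) _
        exact (eLpNorm'_mono_measure _ Measure.restrict_le_self hr'0.le).trans (hHLS _ hgm)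
    _ = (ENNReal.ofReal ((2 * R) ^ (s - s')) * VB ^ (s' / n)) * C * (VB⁻¹ ^ (1 / t) *
        eLpNorm' ((Metric.ball x₀ R).indicator g) t volume) := by
        rw [hpow]
        ring
    _ = _ := by
        rw [hconst, hft]
        ring

/-! ### Multi-index derivatives and weak derivatives -/

theorem ContDiff.partialDeriv {n : ℕ} {f : EuclideanSpace ℝ (Fin n) → ℝ} (hf : ContDiff ℝ ∞ f)
    (i : Fin n) : ContDiff ℝ ∞ (partialDeriv i f) :=
  (hf.fderiv_right (m := ∞) (by simp)).clm_apply contDiff_const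

theorem ContDiff.partialDeriv_iterate {n : ℕ} {f : EuclideanSpace ℝ (Fin n) → ℝ}
    (hf : ContDiff ℝ ∞ f) (i : Fin n) (k : ℕ) :
    ContDiff ℝ ∞ ((_root_.partialDeriv i)^[k] f) := by
  induction k with
  | zero => exact hf
  | succ k ih =>
    rw [Function.iterate_succ_apply']
    exact ih.partialDeriv i

theorem partialDeriv_comm {n : ℕ} {f : EuclideanSpace ℝ (Fin n) → ℝ} (hf : ContDiff ℝ ∞ f)
    (i j : Fin n) : partialDeriv i (partialDeriv j f) = partialDeriv j (partialDeriv i f) := by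
  have key : ∀ (i j : Fin n) (x : EuclideanSpace ℝ (Fin n)), partialDeriv i (partialDeriv j f) x =
      fderiv ℝ (fderiv ℝ f) x (EuclideanSpace.single i 1) (EuclideanSpace.single j 1) := by
    intro i j x
    have hd : DifferentiableAt ℝ (fderiv ℝ f) x :=
      (hf.fderiv_right (m := ∞) (by simp)).differentiable (by simp) x
    rw [partialDeriv, show partialDeriv j f = fun y => fderiv ℝ f y (EuclideanSpace.single j 1)
      from rfl, fderiv_clm_apply hd (differentiableAt_const _)]
    simp
  funext x
  rw [key, key]
  exact (hf.contDiffAt.isSymmSndFDerivAt (by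
    simpa using ENat.LEInfty.out)).eq _ _

theorem partialDeriv_iterate_comm {n : ℕ} {f : EuclideanSpace ℝ (Fin n) → ℝ}
    (hf : ContDiff ℝ ∞ f) (i j : Fin n) (k : ℕ) :
    (partialDeriv j)^[k] (partialDeriv i f) = partialDeriv i ((partialDeriv j)^[k] f) := by
  induction k with
  | zero => rfl
  | succ k ih =>
    rw [Function.iterate_succ_apply', ih, partialDeriv_comm (hf.partialDeriv_iterate j k),
      ← Function.iterate_succ_apply' (partialDeriv j)]

/-- The part of `multiDeriv σ` that differentiates in the directions of the list `L` only. -/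
noncomputable def listDeriv {n : ℕ} (σ : Fin n → ℕ) (L : List (Fin n))
    (f : EuclideanSpace ℝ (Fin n) → ℝ) : EuclideanSpace ℝ (Fin n) → ℝ :=
  L.foldr (fun i g => (partialDeriv i)^[σ i] g) f

theorem ContDiff.listDeriv {n : ℕ} {f : EuclideanSpace ℝ (Fin n) → ℝ} (hf : ContDiff ℝ ∞ f)
    (σ : Fin n → ℕ) (L : List (Fin n)) : ContDiff ℝ ∞ (listDeriv σ L f) := by
  induction L with
  | nil => exact hf
  | cons j L ih => exact ih.partialDeriv_iterate j (σ j)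

theorem listDeriv_partialDeriv {n : ℕ} {f : EuclideanSpace ℝ (Fin n) → ℝ} (hf : ContDiff ℝ ∞ f)
    (σ : Fin n → ℕ) (i : Fin n) (L : List (Fin n)) :
    listDeriv σ L (partialDeriv i f) = partialDeriv i (listDeriv σ L f) := by
  induction L with
  | nil => rfl
  | cons j L ih =>
    change (partialDeriv j)^[σ j] (listDeriv σ L _) = partialDeriv i ((partialDeriv j)^[σ j] _)
    rw [ih, partialDeriv_iterate_comm (hf.listDeriv σ L)]
    rfl

theorem listDeriv_add_single {n : ℕ} {f : EuclideanSpace ℝ (Fin n) → ℝ} (hf : ContDiff ℝ ∞ f)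
    (σ : Fin n → ℕ) (i : Fin n) (L : List (Fin n)) (hL : L.Nodup) :
    listDeriv (σ + Pi.single i 1) L f =
      if i ∈ L then listDeriv σ L (partialDeriv i f) else listDeriv σ L f := by
  induction L with
  | nil => simp [listDeriv]
  | cons j L ih =>
    have ih := ih hL.of_cons
    have hj : j ∉ L := (List.nodup_cons.1 hL).1
    change (partialDeriv j)^[(σ + Pi.single i 1 : Fin n → ℕ) j] (listDeriv (σ + Pi.single i 1) L f) =
      if i ∈ j :: L then (partialDeriv j)^[σ j] (listDeriv σ L (partialDeriv i f))
        else (partialDeriv j)^[σ j] (listDeriv σ L f)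
    rcases eq_or_ne i j with rfl | hij
    · rw [ih, if_neg hj, if_pos List.mem_cons_self, Pi.add_apply, Pi.single_eq_same,
        Function.iterate_succ_apply, listDeriv_partialDeriv hf]
    · rw [ih, Pi.add_apply, Pi.single_eq_of_ne hij.symm, add_zero]
      by_cases h : i ∈ L <;> simp [h, hij]

theorem multiDeriv_add_single {n : ℕ} {f : EuclideanSpace ℝ (Fin n) → ℝ} (hf : ContDiff ℝ ∞ f)
    (σ : Fin n → ℕ) (i : Fin n) :
    multiDeriv (σ + Pi.single i 1) f = multiDeriv σ (partialDeriv i f) := by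
  have := listDeriv_add_single hf σ i _ (List.nodup_finRange n)
  rwa [if_pos (List.mem_finRange i)] at this

theorem multiDeriv_zero {n : ℕ} (f : EuclideanSpace ℝ (Fin n) → ℝ) : multiDeriv 0 f = f := by
  have : ∀ L : List (Fin n), L.foldr (fun i g => (partialDeriv i)^[(0 : Fin n → ℕ) i] g) f = f := by
    intro L
    induction L with
    | nil => rfl
    | cons j L ih => simp
  exact this _

theorem multiDeriv_single {n : ℕ} {f : EuclideanSpace ℝ (Fin n) → ℝ} (hf : ContDiff ℝ ∞ f)
    (i : Fin n) : multiDeriv (Pi.single i 1) f = partialDeriv i f := by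
  rw [← zero_add (Pi.single i 1), multiDeriv_add_single hf, multiDeriv_zero]

theorem tsupport_partialDeriv_subset {n : ℕ} (f : EuclideanSpace ℝ (Fin n) → ℝ) (i : Fin n) :
    tsupport (partialDeriv i f) ⊆ tsupport f :=
  tsupport_fderiv_apply_subset ℝ _

theorem sum_add_single {n : ℕ} (σ : Fin n → ℕ) (i : Fin n) :
    ∑ j, (σ + Pi.single i 1 : Fin n → ℕ) j = ∑ j, σ j + 1 := by
  simp [Finset.sum_add_distrib]

theorem HasWeakDeriv.ae_eq {n : ℕ} {Ω : Set (EuclideanSpace ℝ (Fin n))} (hΩ : IsOpen Ω)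
    {σ : Fin n → ℕ} {u g g' : EuclideanSpace ℝ (Fin n) → ℝ} (h : HasWeakDeriv Ω σ u g)
    (h' : HasWeakDeriv Ω σ u g') : g =ᵐ[volume.restrict Ω] g' := by
  have h0 : ∀ᵐ x ∂volume, x ∈ Ω → (g - g') x = 0 := by
    refine hΩ.ae_eq_zero_of_integral_contDiff_smul_eq_zero (h.2.1.sub h'.2.1) ?_
    intro φ hφ hc hs
    have e := (h.2.2 φ hφ hc hs).symm.trans (h'.2.2 φ hφ hc hs)
    have e' : ∫ x in Ω, g x * φ x = ∫ x in Ω, g' x * φ x :=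
      mul_left_cancel₀ (pow_ne_zero _ (by norm_num)) e
    have hsupp : ∀ x, φ x • (g - g') x = Ω.indicator (fun x => g x * φ x - g' x * φ x) x := by
      intro x
      by_cases hx : x ∈ Ω
      · simp [hx]
        ring
      · have : φ x = 0 := image_eq_zero_of_notMem_tsupport fun hx' => hx (hs hx')
        simp [hx, this]
    simp_rw [hsupp]
    have hi : ∀ {f : EuclideanSpace ℝ (Fin n) → ℝ}, LocallyIntegrableOn f Ω volume →
        Integrable (fun x => f x * φ x) (volume.restrict Ω) := by
      intro f hf
      have hK : IntegrableOn f (tsupport φ) volume := hf.integrableOn_compact_subset hs hc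
      have h1 : IntegrableOn (fun x => f x * φ x) (tsupport φ) volume :=
        hK.mul_continuousOn hφ.continuous.continuousOn hc
      refine IntegrableOn.mono_set ?_ (subset_univ Ω)
      refine (integrableOn_iff_integrable_of_support_subset ?_).1 h1 |>.integrableOn
      intro x hx
      refine subset_tsupport _ (Function.mem_support.2 fun h0 => hx ?_)
      simp [h0]
    rw [integral_indicator hΩ.measurableSet, integral_sub (hi h.2.1) (hi h'.2.1), e', sub_self]
  exact (ae_restrict_iff' hΩ.measurableSet).2 (h0.mono fun x hx hxΩ => sub_eq_zero.1 (hx hxΩ))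

theorem hasWeakDeriv_weakDeriv {n : ℕ} {Ω : Set (EuclideanSpace ℝ (Fin n))} {σ : Fin n → ℕ}
    {u : EuclideanSpace ℝ (Fin n) → ℝ} (h : ∃ g, HasWeakDeriv Ω σ u g) :
    HasWeakDeriv Ω σ u (weakDeriv Ω σ u) := by
  rw [weakDeriv, dif_pos h]
  exact h.choose_spec

theorem hasWeakDeriv_zero {n : ℕ} {Ω : Set (EuclideanSpace ℝ (Fin n))}
    {u : EuclideanSpace ℝ (Fin n) → ℝ} (h : LocallyIntegrableOn u Ω volume) :
    HasWeakDeriv Ω 0 u u :=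
  ⟨h, h, fun φ _ _ _ => by simp [multiDeriv_zero]⟩

/-- A weak derivative of order `σ + eᵢ` of `u` is a first-order weak derivative of `∂_σ u`. -/
theorem HasWeakDeriv.single {n : ℕ} {Ω : Set (EuclideanSpace ℝ (Fin n))} {σ : Fin n → ℕ}
    {i : Fin n} {u g h : EuclideanSpace ℝ (Fin n) → ℝ} (hg : HasWeakDeriv Ω σ u g)
    (hh : HasWeakDeriv Ω (σ + Pi.single i 1) u h) : HasWeakDeriv Ω (Pi.single i 1) g h := by
  refine ⟨hg.2.1, hh.2.1, fun φ hφ hc hs => ?_⟩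
  have hsub := tsupport_partialDeriv_subset φ i
  have e1 := hg.2.2 _ (hφ.partialDeriv i)
    (hc.of_isClosed_subset (isClosed_tsupport _) hsub) (hsub.trans hs)
  have e2 := hh.2.2 φ hφ hc hs
  rw [multiDeriv_add_single hφ, e1, sum_add_single, pow_succ, mul_assoc] at e2
  rw [multiDeriv_single hφ, mul_left_cancel₀ (pow_ne_zero _ (by norm_num)) e2]
  simp

theorem MemSobolev.hasWeakDeriv {n ℓ : ℕ} {p : ℝ≥0∞} {Ω : Set (EuclideanSpace ℝ (Fin n))}
    {u : EuclideanSpace ℝ (Fin n) → ℝ} (h : MemSobolev ℓ p Ω u) {σ : Fin n → ℕ}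
    (hσ : ∑ i, σ i ≤ ℓ) : HasWeakDeriv Ω σ u (weakDeriv Ω σ u) :=
  let ⟨g, _, hg⟩ := h.2 σ hσ
  hasWeakDeriv_weakDeriv ⟨g, hg⟩

theorem MemSobolev.memLp_weakDeriv {n ℓ : ℕ} {p : ℝ≥0∞} {Ω : Set (EuclideanSpace ℝ (Fin n))}
    (hΩ : IsOpen Ω) {u : EuclideanSpace ℝ (Fin n) → ℝ} (h : MemSobolev ℓ p Ω u) {σ : Fin n → ℕ}
    (hσ : ∑ i, σ i ≤ ℓ) : MemLp (weakDeriv Ω σ u) p (volume.restrict Ω) := by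
  obtain ⟨g, hgp, hg⟩ := h.2 σ hσ
  exact hgp.ae_eq (hg.ae_eq hΩ (h.hasWeakDeriv hσ))

theorem MemSobolev.weakDeriv_zero_ae_eq {n ℓ : ℕ} {p : ℝ≥0∞} {Ω : Set (EuclideanSpace ℝ (Fin n))}
    (hΩ : IsOpen Ω) {u : EuclideanSpace ℝ (Fin n) → ℝ} (h : MemSobolev ℓ p Ω u) :
    weakDeriv Ω 0 u =ᵐ[volume.restrict Ω] u := by
  have h0 := h.hasWeakDeriv (σ := 0) (by simp)
  exact h0.ae_eq hΩ (hasWeakDeriv_zero h0.1)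

/-! ### The mean oscillation of a function is bounded by the potential of its gradient -/

theorem lintegral_homothety {n : ℕ} (x : EuclideanSpace ℝ (Fin n)) {t : ℝ} (ht : 0 < t)
    {f : EuclideanSpace ℝ (Fin n) → ℝ≥0∞} (hf : Measurable f) :
    ∫⁻ y, f (x + t • (y - x)) = ENNReal.ofReal ((t ^ n)⁻¹) * ∫⁻ z, f z := by
  have h1 : ∀ y, f (x + t • (y - x)) = (fun z => f (z + (x - t • x))) (t • y) := by
    intro y
    simp only
    congr 1
    rw [smul_sub]
    abel
  simp_rw [h1]
  rw [← lintegral_map (μ := volume) (f := fun z => f (z + (x - t • x))) (by fun_prop)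
    (measurable_const_smul t), Measure.map_addHaar_smul _ ht.ne', lintegral_smul_measure,
    finrank_euclideanSpace_fin, abs_of_pos (by positivity), lintegral_add_right_eq_self]
  rfl

/-- A function whose derivative at `z` has norm at most `G z` varies on a segment by at most the
length of the segment times the mean of `G` over it. -/
theorem enorm_sub_le_lintegral_segment {n : ℕ} {f : EuclideanSpace ℝ (Fin n) → ℝ}
    (hf : ContDiff ℝ ∞ f) {s : Set (EuclideanSpace ℝ (Fin n))} (hs : Convex ℝ s)
    {G : EuclideanSpace ℝ (Fin n) → ℝ≥0∞} (hG : ∀ z ∈ s, ∀ w, ‖fderiv ℝ f z w‖ₑ ≤ ‖w‖ₑ * G z)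
    {x y : EuclideanSpace ℝ (Fin n)} (hx : x ∈ s) (hy : y ∈ s) :
    ‖f x - f y‖ₑ ≤ ∫⁻ t in Ioc (0 : ℝ) 1, ‖x - y‖ₑ * G (x + t • (y - x)) := by
  have hder : ∀ t : ℝ, HasDerivAt (fun t : ℝ => f (x + t • (y - x)))
      (fderiv ℝ f (x + t • (y - x)) (y - x)) t := by
    intro t
    have h1 : HasDerivAt (fun t : ℝ => x + t • (y - x)) (y - x) t := by
      simpa using ((hasDerivAt_id t).smul_const (y - x)).const_add x
    exact ((hf.differentiable (by simp) _).hasFDerivAt).comp_hasDerivAt t h1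
  have hcont : Continuous fun t : ℝ => fderiv ℝ f (x + t • (y - x)) (y - x) :=
    ((hf.continuous_fderiv (by simp)).comp (by fun_prop)).clm_apply continuous_const
  have hint := intervalIntegral.integral_eq_sub_of_hasDerivAt (a := 0) (b := 1)
    (fun t _ => hder t) (hcont.intervalIntegrable _ _)
  simp only [one_smul, add_sub_cancel, zero_smul, add_zero] at hint
  rw [← enorm_neg, neg_sub, ← hint, intervalIntegral.integral_of_le zero_le_one]
  refine (enorm_integral_le_lintegral_enorm _).trans ?_
  refine setLIntegral_mono' measurableSet_Ioc fun t ht => ?_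
  rw [← enorm_neg (x - y), neg_sub]
  refine hG _ ?_ _
  exact hs.add_smul_sub_mem hx hy ⟨ht.1.le, ht.2⟩

theorem lintegral_Ioc_rpow_le {n : ℕ} (hn : n ≠ 0) {d : ℝ} (hd : 0 < d) :
    ∫⁻ t in Ioc (0 : ℝ) 1, {t : ℝ | d ≤ t}.indicator
      (fun t => ENNReal.ofReal (t ^ (-(n : ℝ) - 1))) t ≤ ENNReal.ofReal (d ^ (-(n : ℝ)) / n) := by
  have hn0 : (0 : ℝ) < n := by exact_mod_cast Nat.pos_of_ne_zero hn
  have hlt : -(n : ℝ) - 1 < -1 := by linarith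
  calc _ ≤ ∫⁻ t, (Ici d).indicator (fun t => ENNReal.ofReal (t ^ (-(n : ℝ) - 1))) t :=
        setLIntegral_le_lintegral _ _
    _ = ∫⁻ t in Ioi d, ENNReal.ofReal (t ^ (-(n : ℝ) - 1)) := by
        rw [lintegral_indicator measurableSet_Ici, setLIntegral_congr Ioi_ae_eq_Ici]
    _ = ENNReal.ofReal (∫ t in Ioi d, t ^ (-(n : ℝ) - 1)) := by
        rw [ofReal_integral_eq_lintegral_ofReal (integrableOn_Ioi_rpow_of_lt hlt hd)]
        exact (ae_restrict_mem measurableSet_Ioi).mono fun t ht =>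
          Real.rpow_nonneg (hd.le.trans (le_of_lt ht)) _
    _ = _ := by
        rw [integral_Ioi_rpow_of_lt hlt hd, sub_add_cancel, neg_div_neg_eq]

/-- The oscillation of a smooth function around a point of a ball is at most a constant times the
Riesz potential of order one of a majorant `G` of its gradient. -/
theorem lintegral_enorm_sub_le {n : ℕ} (hn : n ≠ 0) {f : EuclideanSpace ℝ (Fin n) → ℝ}
    (hf : ContDiff ℝ ∞ f) {x₀ x : EuclideanSpace ℝ (Fin n)} {ρ : ℝ}
    {G : EuclideanSpace ℝ (Fin n) → ℝ≥0∞} (hGm : Measurable G)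
    (hG : ∀ z ∈ Metric.ball x₀ ρ, ∀ w, ‖fderiv ℝ f z w‖ₑ ≤ ‖w‖ₑ * G z)
    (hx : x ∈ Metric.ball x₀ ρ) :
    ∫⁻ y in Metric.ball x₀ ρ, ‖f x - f y‖ₑ ≤
      ENNReal.ofReal ((2 * ρ) ^ n / n) * rieszPotential 1 ((Metric.ball x₀ ρ).indicator G) x := by
  have hρ : 0 < ρ := Metric.pos_of_mem_ball hx
  have hn0 : (0 : ℝ) < n := by exact_mod_cast Nat.pos_of_ne_zero hn
  have hB : MeasurableSet (Metric.ball x₀ ρ) := Metric.isOpen_ball.measurableSet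
  set B := Metric.ball x₀ ρ with hBdef
  -- The integrand after the substitution `z = x + t (y - x)`; then `|x - z| = t |x - y| ≤ 2 ρ t`.
  obtain ⟨H, hH⟩ : ∃ H : ℝ → EuclideanSpace ℝ (Fin n) → ℝ≥0∞, H = fun t z =>
    {z | ‖x - z‖ ≤ 2 * ρ * t}.indicator
      (fun z => ENNReal.ofReal (‖x - z‖ / t) * B.indicator G z) z := ⟨_, rfl⟩
  have hHm2 : Measurable fun z : ℝ × EuclideanSpace ℝ (Fin n) => H z.1 z.2 := by
    have : (fun z : ℝ × EuclideanSpace ℝ (Fin n) => H z.1 z.2) =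
        {z : ℝ × EuclideanSpace ℝ (Fin n) | ‖x - z.2‖ ≤ 2 * ρ * z.1}.indicator
          (fun z => ENNReal.ofReal (‖x - z.2‖ / z.1) * B.indicator G z.2) := by
      rw [hH]
      rfl
    rw [this]
    have hGB : Measurable (B.indicator G) := hGm.indicator hB
    exact Measurable.indicator (by fun_prop) (measurableSet_le (by fun_prop) (by fun_prop))
  have hHm : ∀ t, Measurable (H t) := fun t => hHm2.comp (measurable_const.prodMk measurable_id)
  calc ∫⁻ y in B, ‖f x - f y‖ₑ
      ≤ ∫⁻ y in B, ∫⁻ t in Ioc (0 : ℝ) 1, H t (x + t • (y - x)) := by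
        refine setLIntegral_mono' hB fun y hy => ?_
        refine (enorm_sub_le_lintegral_segment hf (convex_ball _ _) hG hx hy).trans ?_
        refine setLIntegral_mono' measurableSet_Ioc fun t ht => ?_
        have hmem : x + t • (y - x) ∈ B :=
          (convex_ball x₀ ρ).add_smul_sub_mem hx hy ⟨ht.1.le, ht.2⟩
        have hnorm : ‖x - (x + t • (y - x))‖ = t * ‖x - y‖ := by
          rw [sub_add_cancel_left, norm_neg, norm_smul, Real.norm_eq_abs, abs_of_pos ht.1,
            norm_sub_rev]
        have hle : ‖x - y‖ ≤ 2 * ρ := by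
          rw [← dist_eq_norm]
          have := dist_triangle_right x y x₀
          rw [hBdef, Metric.mem_ball] at hx hy
          linarith
        have hin : x + t • (y - x) ∈ {z | ‖x - z‖ ≤ 2 * ρ * t} := by
          rw [mem_ofPred_eq, hnorm, mul_comm]
          exact mul_le_mul_of_nonneg_right hle ht.1.le
        simp only [hH]
        rw [indicator_of_mem hin, indicator_of_mem hmem, hnorm, mul_div_cancel_left₀ _ ht.1.ne',
          ofReal_norm]
    _ ≤ ∫⁻ y, ∫⁻ t in Ioc (0 : ℝ) 1, H t (x + t • (y - x)) := setLIntegral_le_lintegral _ _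
    _ = ∫⁻ t in Ioc (0 : ℝ) 1, ∫⁻ y, H t (x + t • (y - x)) := by
        refine lintegral_lintegral_swap (f := fun y t => H t (x + t • (y - x)))
          (Measurable.aemeasurable ?_)
        exact hHm2.comp (f := fun z : EuclideanSpace ℝ (Fin n) × ℝ =>
          (z.2, x + z.2 • (z.1 - x))) (by fun_prop)
    _ = ∫⁻ t in Ioc (0 : ℝ) 1, ∫⁻ z, ENNReal.ofReal ((t ^ n)⁻¹) * H t z := by
        refine setLIntegral_congr_fun measurableSet_Ioc fun t ht => ?_
        rw [lintegral_homothety x ht.1 (hHm t), lintegral_const_mul _ (hHm t)]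
    _ = ∫⁻ z, ∫⁻ t in Ioc (0 : ℝ) 1, ENNReal.ofReal ((t ^ n)⁻¹) * H t z := by
        refine lintegral_lintegral_swap (f := fun t z => ENNReal.ofReal ((t ^ n)⁻¹) * H t z)
          (Measurable.aemeasurable ?_)
        exact Measurable.mul (by fun_prop) hHm2
    _ ≤ ∫⁻ z, ENNReal.ofReal ((2 * ρ) ^ n / n) *
          (B.indicator G z * ENNReal.ofReal (‖x - z‖ ^ ((1 : ℝ) - n))) := by
        have : NeZero n := ⟨hn⟩
        have hne : ∀ᵐ y ∂(volume : Measure (EuclideanSpace ℝ (Fin n))), y ≠ x :=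
          compl_mem_ae_iff.2 (measure_singleton x)
        refine lintegral_mono_ae (hne.mono fun z hz => ?_)
        have hpos : 0 < ‖x - z‖ := norm_pos_iff.2 (sub_ne_zero.2 hz.symm)
        set d := ‖x - z‖ / (2 * ρ) with hd
        have hd0 : 0 < d := by positivity
        calc _ = ∫⁻ t in Ioc (0 : ℝ) 1, (ENNReal.ofReal ‖x - z‖ * B.indicator G z) *
              {t : ℝ | d ≤ t}.indicator (fun t => ENNReal.ofReal (t ^ (-(n : ℝ) - 1))) t := by
              refine setLIntegral_congr_fun measurableSet_Ioc fun t ht => ?_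
              have hiff : z ∈ {z | ‖x - z‖ ≤ 2 * ρ * t} ↔ t ∈ {t | d ≤ t} := by
                rw [mem_ofPred_eq, mem_ofPred_eq, hd, div_le_iff₀ (by positivity), mul_comm]
              by_cases hdt : t ∈ {t | d ≤ t}
              · have e : (t ^ n)⁻¹ * (‖x - z‖ / t) = ‖x - z‖ * t ^ (-(n : ℝ) - 1) := by
                  rw [Real.rpow_sub_one ht.1.ne', Real.rpow_neg ht.1.le, Real.rpow_natCast]
                  ring
                simp only [hH]
                rw [indicator_of_mem (hiff.2 hdt), indicator_of_mem hdt,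
                  ← mul_assoc, ← ENNReal.ofReal_mul (inv_nonneg.2 (pow_nonneg ht.1.le _)), e,
                  ENNReal.ofReal_mul hpos.le]
                ring
              · simp only [hH]
                rw [indicator_of_notMem (fun h => hdt (hiff.1 h)),
                  indicator_of_notMem hdt, mul_zero, mul_zero]
          _ ≤ (ENNReal.ofReal ‖x - z‖ * B.indicator G z) * ENNReal.ofReal (d ^ (-(n : ℝ)) / n) := by
              have hm : Measurable ({t : ℝ | d ≤ t}.indicator
                  fun t => ENNReal.ofReal (t ^ (-(n : ℝ) - 1))) :=
                Measurable.indicator (by fun_prop) measurableSet_Ici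
              rw [lintegral_const_mul _ hm]
              exact mul_le_mul_right (lintegral_Ioc_rpow_le hn hd0) _
          _ = _ := by
              have e : ‖x - z‖ * (d ^ (-(n : ℝ)) / n) =
                  (2 * ρ) ^ n / n * ‖x - z‖ ^ ((1 : ℝ) - n) := by
                rw [hd, Real.div_rpow hpos.le (by positivity), Real.rpow_neg (by positivity) (n : ℝ),
                  Real.rpow_neg (by positivity) (n : ℝ), Real.rpow_natCast, Real.rpow_natCast,
                  Real.rpow_sub hpos, Real.rpow_one, Real.rpow_natCast]
                field_simp
              rw [mul_right_comm, ← ENNReal.ofReal_mul hpos.le, e,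
                ENNReal.ofReal_mul (by positivity)]
              ring
    _ = _ := by
        rw [lintegral_const_mul' _ _ ENNReal.ofReal_ne_top]
        rfl

/-! ### Passage to weakly differentiable functions by mollification -/

theorem fderiv_convolution_apply {n : ℕ} {φ u : EuclideanSpace ℝ (Fin n) → ℝ}
    (hφ : ContDiff ℝ ∞ φ) (hc : HasCompactSupport φ) (hu : LocallyIntegrable u volume)
    (x w : EuclideanSpace ℝ (Fin n)) :
    fderiv ℝ (φ ⋆[ContinuousLinearMap.lsmul ℝ ℝ, volume] u) x w =
      ∫ y, fderiv ℝ φ (x - y) w * u y := by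
  rw [(hc.hasFDerivAt_convolution_left (ContinuousLinearMap.lsmul ℝ ℝ) (hφ.of_le (by simp))
    hu x).fderiv, convolution_eq_swap, ContinuousLinearMap.integral_apply]
  · rfl
  · exact ((hc.fderiv ℝ).convolutionExists_left _ (hφ.continuous_fderiv (by simp)) hu
      x).integrable_swap

/-- Mollification commutes with weak derivatives, away from the boundary. -/
theorem fderiv_convolution_single {n : ℕ} {Ω : Set (EuclideanSpace ℝ (Fin n))} (hΩ : IsOpen Ω)
    {i : Fin n} {v h : EuclideanSpace ℝ (Fin n) → ℝ} (hv : IntegrableOn v Ω volume)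
    (hw : HasWeakDeriv Ω (Pi.single i 1) v h)
    {φ : EuclideanSpace ℝ (Fin n) → ℝ} (hφ : ContDiff ℝ ∞ φ) {ε : ℝ}
    (hs : tsupport φ ⊆ Metric.closedBall 0 ε) {x : EuclideanSpace ℝ (Fin n)}
    (hx : Metric.closedBall x ε ⊆ Ω) :
    fderiv ℝ (φ ⋆[ContinuousLinearMap.lsmul ℝ ℝ, volume] (Ω.indicator v)) x
      (EuclideanSpace.single i 1) = ∫ y, φ (x - y) * Ω.indicator h y := by
  have hc : HasCompactSupport φ :=
    (isCompact_closedBall 0 ε).of_isClosed_subset (isClosed_tsupport φ) hs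
  have hv0 : Integrable (Ω.indicator v) volume := (integrable_indicator_iff hΩ.measurableSet).2 hv
  rw [fderiv_convolution_apply hφ hc hv0.locallyIntegrable]
  have hψ : ContDiff ℝ ∞ fun y => φ (x - y) := hφ.comp (contDiff_const.sub contDiff_id)
  have hψs : tsupport (fun y => φ (x - y)) ⊆ Metric.closedBall x ε := by
    refine closure_minimal (fun y hy => ?_) Metric.isClosed_closedBall
    have := hs (subset_tsupport φ (show x - y ∈ Function.support φ from hy))
    rwa [mem_closedBall_zero_iff, ← dist_eq_norm, dist_comm, ← Metric.mem_closedBall] at this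
  have hψc : HasCompactSupport fun y => φ (x - y) :=
    (isCompact_closedBall x ε).of_isClosed_subset (isClosed_tsupport _) hψs
  have e := hw.2.2 _ hψ hψc (hψs.trans hx)
  have hd : ∀ y, partialDeriv i (fun y => φ (x - y)) y =
      -fderiv ℝ φ (x - y) (EuclideanSpace.single i 1) := by
    intro y
    have h1 : HasFDerivAt (fun y => x - y)
        (-ContinuousLinearMap.id ℝ (EuclideanSpace ℝ (Fin n))) y := by
      simpa using (hasFDerivAt_id y).const_sub x
    have h2 := ((hφ.differentiable (by simp) (x - y)).hasFDerivAt).comp y h1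
    have h3 : fderiv ℝ (fun y => φ (x - y)) y = _ := h2.fderiv
    rw [partialDeriv, h3]
    simp
  rw [multiDeriv_single hψ, ← integral_indicator hΩ.measurableSet,
    ← integral_indicator hΩ.measurableSet] at e
  have e1 : ∀ y, Ω.indicator (fun y => v y * partialDeriv i (fun y => φ (x - y)) y) y =
      -(fderiv ℝ φ (x - y) (EuclideanSpace.single i 1) * Ω.indicator v y) := by
    intro y
    by_cases hy : y ∈ Ω
    · rw [indicator_of_mem hy, indicator_of_mem hy, hd]
      ring
    · simp [hy]
  have e2 : ∀ y, Ω.indicator (fun y => h y * φ (x - y)) y = φ (x - y) * Ω.indicator h y := by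
    intro y
    by_cases hy : y ∈ Ω
    · rw [indicator_of_mem hy, indicator_of_mem hy, mul_comm]
    · simp [hy]
  simp_rw [e1, e2] at e
  rw [integral_neg] at e
  simpa using e

/-- The convolution `∫ φ(z - y) g(y) dy` of a nonnegative kernel with an extended function. -/
noncomputable def lconvKernel {n : ℕ} (φ : EuclideanSpace ℝ (Fin n) → ℝ)
    (g : EuclideanSpace ℝ (Fin n) → ℝ≥0∞) (z : EuclideanSpace ℝ (Fin n)) : ℝ≥0∞ :=
  ∫⁻ y, ENNReal.ofReal (φ (z - y)) * g y

theorem measurable_lconvKernel {n : ℕ} {φ : EuclideanSpace ℝ (Fin n) → ℝ} (hφ : Measurable φ)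
    {g : EuclideanSpace ℝ (Fin n) → ℝ≥0∞} (hg : Measurable g) : Measurable (lconvKernel φ g) := by
  refine Measurable.lintegral_prod_right' (f := fun z : EuclideanSpace ℝ (Fin n) ×
    EuclideanSpace ℝ (Fin n) => ENNReal.ofReal (φ (z.1 - z.2)) * g z.2) ?_
  fun_prop

theorem enorm_fderiv_convolution_le {n : ℕ} {Ω : Set (EuclideanSpace ℝ (Fin n))} (hΩ : IsOpen Ω)
    {v : EuclideanSpace ℝ (Fin n) → ℝ} {h : Fin n → EuclideanSpace ℝ (Fin n) → ℝ}
    (hv : IntegrableOn v Ω volume) (hh : ∀ i, IntegrableOn (h i) Ω volume)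
    (hw : ∀ i, HasWeakDeriv Ω (Pi.single i 1) v (h i))
    {g : EuclideanSpace ℝ (Fin n) → ℝ≥0∞}
    (hg : Ω.indicator (fun y => ∑ i, ‖h i y‖ₑ) =ᵐ[volume] g)
    {φ : EuclideanSpace ℝ (Fin n) → ℝ} (hφ : ContDiff ℝ ∞ φ) (hφ0 : ∀ y, 0 ≤ φ y) {ε : ℝ}
    (hs : tsupport φ ⊆ Metric.closedBall 0 ε) {x : EuclideanSpace ℝ (Fin n)}
    (hx : Metric.closedBall x ε ⊆ Ω) (w : EuclideanSpace ℝ (Fin n)) :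
    ‖fderiv ℝ (φ ⋆[ContinuousLinearMap.lsmul ℝ ℝ, volume] (Ω.indicator v)) x w‖ₑ ≤
      ‖w‖ₑ * lconvKernel φ g x := by
  set F := fderiv ℝ (φ ⋆[ContinuousLinearMap.lsmul ℝ ℝ, volume] (Ω.indicator v)) x with hF
  have hwsum : F w = ∑ i, w i * ∫ y, φ (x - y) * Ω.indicator (h i) y := by
    conv_lhs => rw [← (EuclideanSpace.basisFun (Fin n) ℝ).sum_repr w]
    simp only [EuclideanSpace.basisFun_repr, EuclideanSpace.basisFun_apply, map_sum, map_smul,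
      smul_eq_mul]
    refine Finset.sum_congr rfl fun i _ => ?_
    rw [hF, fderiv_convolution_single hΩ hv (hw i) hφ hs hx]
  have hterm : ∀ i, ‖w i * ∫ y, φ (x - y) * Ω.indicator (h i) y‖ₑ ≤
      ‖w‖ₑ * ∫⁻ y, ENNReal.ofReal (φ (x - y)) * Ω.indicator (fun y => ‖h i y‖ₑ) y := by
    intro i
    rw [enorm_mul]
    gcongr
    · rw [← ofReal_norm, ← ofReal_norm]
      exact ENNReal.ofReal_le_ofReal (PiLp.norm_apply_le w i)
    · refine (enorm_integral_le_lintegral_enorm _).trans_eq (lintegral_congr fun y => ?_)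
      rw [enorm_mul, Real.enorm_of_nonneg (hφ0 _)]
      by_cases hy : y ∈ Ω <;> simp [hy]
  rw [hwsum]
  refine (enorm_sum_le _ _).trans ((Finset.sum_le_sum fun i _ => hterm i).trans_eq ?_)
  rw [← Finset.mul_sum, ← lintegral_finsetSum']
  · congr 1
    refine lintegral_congr_ae (hg.mono fun y hy => ?_)
    simp only
    rw [← hy, ← Finset.mul_sum]
    by_cases hy : y ∈ Ω <;> simp [hy]
  · intro i _
    refine AEMeasurable.mul ?_ ?_
    · have := hφ.continuous.measurable
      fun_prop
    · exact (aemeasurable_indicator_iff hΩ.measurableSet).2 (hh i).aestronglyMeasurable.enorm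

/-- Convolution commutes with Riesz potentials. -/
theorem rieszPotential_lconvKernel {n : ℕ} {φ : EuclideanSpace ℝ (Fin n) → ℝ} (hφ : Measurable φ)
    {g : EuclideanSpace ℝ (Fin n) → ℝ≥0∞} (hg : Measurable g) (s : ℝ)
    (x : EuclideanSpace ℝ (Fin n)) :
    rieszPotential s (lconvKernel φ g) x = lconvKernel φ (rieszPotential s g) x := by
  have h1 : ∀ z, lconvKernel φ g z = ∫⁻ w, ENNReal.ofReal (φ w) * g (z - w) := by
    intro z
    rw [lconvKernel, ← lintegral_sub_left_eq_self _ z]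
    simp
  have h2 : lconvKernel φ (rieszPotential s g) x =
      ∫⁻ w, ENNReal.ofReal (φ w) * rieszPotential s g (x - w) := by
    rw [lconvKernel, ← lintegral_sub_left_eq_self _ x]
    simp
  have h3 : ∀ w, rieszPotential s g (x - w) =
      ∫⁻ z, g (z - w) * ENNReal.ofReal (‖x - z‖ ^ (s - n)) := by
    intro w
    rw [rieszPotential, ← lintegral_sub_right_eq_self _ w]
    simp
  rw [h2, rieszPotential]
  simp_rw [h1, h3]
  have h4 : ∀ z, (∫⁻ w, ENNReal.ofReal (φ w) * g (z - w)) * ENNReal.ofReal (‖x - z‖ ^ (s - n)) =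
      ∫⁻ w, ENNReal.ofReal (φ w) * g (z - w) * ENNReal.ofReal (‖x - z‖ ^ (s - n)) := fun z =>
    (lintegral_mul_const' _ _ ENNReal.ofReal_ne_top).symm
  have h5 : ∀ w, ENNReal.ofReal (φ w) * ∫⁻ z, g (z - w) * ENNReal.ofReal (‖x - z‖ ^ (s - n)) =
      ∫⁻ z, ENNReal.ofReal (φ w) * (g (z - w) * ENNReal.ofReal (‖x - z‖ ^ (s - n))) := fun w =>
    (lintegral_const_mul' _ _ ENNReal.ofReal_ne_top).symm
  simp_rw [h4, h5, ← mul_assoc]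
  refine lintegral_lintegral_swap (Measurable.aemeasurable ?_)
  simp only [Function.uncurry_def]
  fun_prop

/-- The bound for mollifications, on a ball that stays away from the boundary of `B(x₀,R)`. -/
theorem lintegral_enorm_convolution_sub_le {n : ℕ} (hn : n ≠ 0) {x₀ : EuclideanSpace ℝ (Fin n)}
    {R ρ ε : ℝ} (hε : ρ + ε ≤ R)
    {v : EuclideanSpace ℝ (Fin n) → ℝ} {h : Fin n → EuclideanSpace ℝ (Fin n) → ℝ}
    (hv : IntegrableOn v (Metric.ball x₀ R) volume)
    (hh : ∀ i, IntegrableOn (h i) (Metric.ball x₀ R) volume)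
    (hw : ∀ i, HasWeakDeriv (Metric.ball x₀ R) (Pi.single i 1) v (h i))
    {g : EuclideanSpace ℝ (Fin n) → ℝ≥0∞} (hgm : Measurable g)
    (hg : (Metric.ball x₀ R).indicator (fun y => ∑ i, ‖h i y‖ₑ) =ᵐ[volume] g)
    {φ : EuclideanSpace ℝ (Fin n) → ℝ} (hφ : ContDiff ℝ ∞ φ) (hφ0 : ∀ y, 0 ≤ φ y)
    (hs : tsupport φ ⊆ Metric.closedBall 0 ε) {x : EuclideanSpace ℝ (Fin n)}
    (hx : x ∈ Metric.ball x₀ ρ) :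
    ∫⁻ y in Metric.ball x₀ ρ,
        ‖(φ ⋆[ContinuousLinearMap.lsmul ℝ ℝ, volume] ((Metric.ball x₀ R).indicator v)) x -
          (φ ⋆[ContinuousLinearMap.lsmul ℝ ℝ, volume] ((Metric.ball x₀ R).indicator v)) y‖ₑ ≤
      ENNReal.ofReal ((2 * ρ) ^ n / n) * lconvKernel φ (rieszPotential 1 g) x := by
  have hB : MeasurableSet (Metric.ball x₀ R) := Metric.isOpen_ball.measurableSet
  have hc : HasCompactSupport φ :=
    (isCompact_closedBall 0 ε).of_isClosed_subset (isClosed_tsupport φ) hs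
  have hv0 : Integrable ((Metric.ball x₀ R).indicator v) volume :=
    (integrable_indicator_iff hB).2 hv
  have hsmooth := hc.contDiff_convolution_left (n := ⊤) (ContinuousLinearMap.lsmul ℝ ℝ) hφ
    hv0.locallyIntegrable
  refine (lintegral_enorm_sub_le hn hsmooth (measurable_lconvKernel hφ.continuous.measurable hgm)
    (fun z hz w => ?_) hx).trans ?_
  · refine enorm_fderiv_convolution_le Metric.isOpen_ball hv hh hw hg hφ hφ0 hs ?_ w
    refine Metric.closedBall_subset_ball' ?_
    rw [Metric.mem_ball] at hz
    linarith
  · gcongr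
    rw [← rieszPotential_lconvKernel hφ.continuous.measurable hgm]
    refine lintegral_mono fun y => ?_
    gcongr
    exact indicator_le_self _ _ y

theorem eLpNorm'_lt_top_of_memLp {n : ℕ} {x₀ : EuclideanSpace ℝ (Fin n)} {R p : ℝ} (hp : 0 < p)
    (hR : 0 < R) {f : EuclideanSpace ℝ (Fin n) → ℝ}
    (hf : MemLp f (ENNReal.ofReal p) (volume.restrict (Metric.ball x₀ R))) :
    eLpNorm' f p (ballMeasure x₀ R) < ⊤ := by
  have h := hf.2
  rw [eLpNorm_eq_eLpNorm' (by simpa using hp) ENNReal.ofReal_ne_top,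
    ENNReal.toReal_ofReal hp.le] at h
  rw [ballMeasure, eLpNorm'_smul_measure hp.le]
  refine ENNReal.mul_lt_top (ENNReal.rpow_lt_top_of_nonneg (by positivity) ?_) h
  exact ENNReal.inv_ne_top.2 (Metric.measure_ball_pos _ _ hR).ne'

theorem eLpNorm'_sum_enorm_le {n : ℕ} {μ : Measure (EuclideanSpace ℝ (Fin n))} {p : ℝ}
    (hp : 1 ≤ p) {ι : Type*} (s : Finset ι) {h : ι → EuclideanSpace ℝ (Fin n) → ℝ≥0∞}
    (hh : ∀ i ∈ s, AEStronglyMeasurable (h i) μ) :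
    eLpNorm' (fun y => ∑ i ∈ s, h i y) p μ ≤ ∑ i ∈ s, eLpNorm' (h i) p μ := by
  have := eLpNorm'_sum_le hh hp
  rwa [show (∑ i ∈ s, h i) = fun y => ∑ i ∈ s, h i y by ext y; simp] at this

theorem lconvKernel_eq_ofReal_convolution {n : ℕ} {x₀ : EuclideanSpace ℝ (Fin n)} {R ρ ε : ℝ}
    (hε : ρ + ε ≤ R) {K : EuclideanSpace ℝ (Fin n) → ℝ≥0∞} (hKm : Measurable K)
    (hK : ∫⁻ y in Metric.ball x₀ R, K y ≠ ⊤)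
    {φ : EuclideanSpace ℝ (Fin n) → ℝ} (hφ : ContDiff ℝ ∞ φ) (hφ0 : ∀ y, 0 ≤ φ y)
    (hs : tsupport φ ⊆ Metric.closedBall 0 ε) {x : EuclideanSpace ℝ (Fin n)}
    (hx : x ∈ Metric.ball x₀ ρ) :
    lconvKernel φ K x = ENNReal.ofReal ((φ ⋆[ContinuousLinearMap.lsmul ℝ ℝ, volume]
      ((Metric.ball x₀ R).indicator fun y => (K y).toReal)) x) := by
  have hB : MeasurableSet (Metric.ball x₀ R) := Metric.isOpen_ball.measurableSet
  have hc : HasCompactSupport φ :=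
    (isCompact_closedBall 0 ε).of_isClosed_subset (isClosed_tsupport φ) hs
  have hK0 : Integrable ((Metric.ball x₀ R).indicator fun y => (K y).toReal) volume :=
    (integrable_indicator_iff hB).2 (integrable_toReal_of_lintegral_ne_top hKm.aemeasurable hK)
  have hint := (hc.convolutionExists_left (ContinuousLinearMap.lsmul ℝ ℝ) hφ.continuous
    hK0.locallyIntegrable x).integrable_swap
  simp only [ContinuousLinearMap.lsmul_apply, smul_eq_mul] at hint
  rw [convolution_eq_swap]
  simp only [ContinuousLinearMap.lsmul_apply, smul_eq_mul]
  rw [ofReal_integral_eq_lintegral_ofReal hint]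
  · refine lintegral_congr_ae ?_
    have hfin := (ae_restrict_iff' hB).1 (ae_lt_top' hKm.aemeasurable hK)
    filter_upwards [hfin] with y hy
    by_cases hyB : y ∈ Metric.ball x₀ R
    · rw [indicator_of_mem hyB, ENNReal.ofReal_mul (hφ0 _), ENNReal.ofReal_toReal (hy hyB).ne]
    · have : φ (x - y) = 0 := by
        refine image_eq_zero_of_notMem_tsupport fun h => hyB ?_
        have := hs h
        rw [mem_closedBall_zero_iff, ← dist_eq_norm] at this
        rw [Metric.mem_ball] at hx ⊢
        have := dist_triangle_left y x₀ x
        linarith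
      simp [this]
  · refine Filter.Eventually.of_forall fun y => mul_nonneg (hφ0 _) ?_
    exact indicator_nonneg (fun _ _ => ENNReal.toReal_nonneg) y

theorem lintegral_ball_le_of_forall_lt {n : ℕ} {x₀ : EuclideanSpace ℝ (Fin n)} {R : ℝ}
    {f : EuclideanSpace ℝ (Fin n) → ℝ≥0∞} {c : ℝ≥0∞}
    (h : ∀ ρ < R, ∫⁻ y in Metric.ball x₀ ρ, f y ≤ c) : ∫⁻ y in Metric.ball x₀ R, f y ≤ c := by
  have hU : Metric.ball x₀ R = ⋃ m : ℕ, Metric.ball x₀ (R - 1 / ((m : ℝ) + 1)) := by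
    ext y
    rw [mem_iUnion]
    constructor
    · intro hy
      rw [Metric.mem_ball] at hy
      obtain ⟨m, hm⟩ := exists_nat_one_div_lt (sub_pos.2 hy)
      exact ⟨m, by rw [Metric.mem_ball]; linarith⟩
    · rintro ⟨m, hm⟩
      refine Metric.ball_subset_ball ?_ hm
      have : (0 : ℝ) ≤ 1 / ((m : ℝ) + 1) := by positivity
      linarith
  have hmono : Monotone fun m : ℕ => Metric.ball x₀ (R - 1 / ((m : ℝ) + 1)) := by
    intro m m' hm
    refine Metric.ball_subset_ball ?_
    have : 1 / ((m' : ℝ) + 1) ≤ 1 / ((m : ℝ) + 1) := by gcongr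
    linarith
  rw [hU, setLIntegral_iUnion_of_directed f hmono.directed_le]
  refine iSup_le fun m => h _ ?_
  have : (0 : ℝ) < 1 / ((m : ℝ) + 1) := by positivity
  linarith

/-- For a weakly differentiable function, the oscillation around almost every point of a ball is
controlled by the Riesz potential of order one of its gradient. -/
theorem lintegral_enorm_sub_le_of_hasWeakDeriv {n : ℕ} (hn : n ≠ 0) {p : ℝ} (hp : 1 < p)
    {x₀ : EuclideanSpace ℝ (Fin n)} {R : ℝ} (hR : 0 < R)
    {v : EuclideanSpace ℝ (Fin n) → ℝ} {h : Fin n → EuclideanSpace ℝ (Fin n) → ℝ}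
    (hv : MemLp v (ENNReal.ofReal p) (volume.restrict (Metric.ball x₀ R)))
    (hh : ∀ i, MemLp (h i) (ENNReal.ofReal p) (volume.restrict (Metric.ball x₀ R)))
    (hw : ∀ i, HasWeakDeriv (Metric.ball x₀ R) (Pi.single i 1) v (h i)) :
    ∀ᵐ x ∂(volume.restrict (Metric.ball x₀ R)),
      ∫⁻ y in Metric.ball x₀ R, ‖v x - v y‖ₑ ≤ ENNReal.ofReal ((2 * R) ^ n / n) *
        rieszPotential 1 ((Metric.ball x₀ R).indicator fun y => ∑ i, ‖h i y‖ₑ) x := by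
  set B := Metric.ball x₀ R with hBdef
  have hB : MeasurableSet B := Metric.isOpen_ball.measurableSet
  have hfinB : IsFiniteMeasure (volume.restrict B) :=
    ⟨by rw [Measure.restrict_apply_univ]; exact measure_ball_lt_top⟩
  have hp1 : 1 ≤ ENNReal.ofReal p := by
    rw [← ENNReal.ofReal_one]
    exact ENNReal.ofReal_le_ofReal hp.le
  have hvi : IntegrableOn v B volume := hv.integrable hp1
  have hhi : ∀ i, IntegrableOn (h i) B volume := fun i => (hh i).integrable hp1
  have hgae : AEMeasurable (fun y => ∑ i, ‖h i y‖ₑ) (volume.restrict B) :=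
    Finset.aemeasurable_fun_sum _ fun i _ => (hh i).1.enorm
  obtain ⟨g, hgm, hg⟩ := (aemeasurable_indicator_iff hB).2 hgae
  have hKeq : rieszPotential 1 (B.indicator fun y => ∑ i, ‖h i y‖ₑ) = rieszPotential 1 g :=
    rieszPotential_congr_ae 1 hg
  set K := rieszPotential 1 g with hK
  have hKm : Measurable K := measurable_rieszPotential 1 hgm
  have hKfin : ∫⁻ y in B, K y ≠ ⊤ := by
    obtain ⟨C, hC, hbd⟩ := eLpNorm'_ballMeasure_rieszPotential_le hn (s := 1) (t := p) (r := 1)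
      one_pos hp le_rfl (by
        have h1 : 1 / p ≤ 1 := by
          rw [div_le_one (by linarith)]
          exact hp.le
        have h2 : (0 : ℝ) ≤ 1 / n := by positivity
        linarith)
    have h1 := hbd x₀ R hR _ hgae
    rw [← hBdef, hKeq] at h1
    have h2 : eLpNorm' (fun y => ∑ i, ‖h i y‖ₑ) p (ballMeasure x₀ R) < ⊤ := by
      refine (eLpNorm'_sum_enorm_le hp.le Finset.univ fun i _ =>
        aestronglyMeasurable_ballMeasure (hh i).1.enorm).trans_lt ?_
      refine ENNReal.sum_lt_top.2 fun i _ => ?_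
      rw [eLpNorm'_enorm]
      exact eLpNorm'_lt_top_of_memLp (by linarith) hR (hh i)
    have h3 : eLpNorm' K 1 (ballMeasure x₀ R) < ⊤ :=
      h1.trans_lt (ENNReal.mul_lt_top (ENNReal.mul_lt_top hC.lt_top ENNReal.ofReal_lt_top) h2)
    rw [ballMeasure, eLpNorm'_smul_measure zero_le_one, eLpNorm'_eq_lintegral_enorm] at h3
    simp only [enorm_eq_self, ENNReal.rpow_one, div_one] at h3
    refine fun htop => h3.ne ?_
    rw [← hBdef, htop, ENNReal.mul_top]
    exact ENNReal.inv_ne_zero.2 measure_ball_lt_top.ne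
  rw [hKeq]
  have hv0 : Integrable (B.indicator v) volume := (integrable_indicator_iff hB).2 hvi
  have hK0 : Integrable (B.indicator fun y => (K y).toReal) volume :=
    (integrable_indicator_iff hB).2 (integrable_toReal_of_lintegral_ne_top hKm.aemeasurable hKfin)
  -- A sequence of mollifiers whose supports shrink to the origin.
  set φ : ℕ → ContDiffBump (0 : EuclideanSpace ℝ (Fin n)) := fun k =>
    ⟨1 / ((k : ℝ) + 1) / 2, 1 / ((k : ℝ) + 1), by positivity, half_lt_self (by positivity)⟩ with hφ
  have hφlim : Filter.Tendsto (fun k => (φ k).rOut) Filter.atTop (𝓝 0) :=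
    tendsto_one_div_add_atTop_nhds_zero_nat
  have hφratio : ∀ᶠ k in Filter.atTop, (φ k).rOut ≤ 2 * (φ k).rIn :=
    Filter.Eventually.of_forall fun k => by
      simp only [hφ]
      linarith
  have limv := ContDiffBump.ae_convolution_tendsto_right_of_locallyIntegrable
    (μ := volume) hφlim hφratio hv0.locallyIntegrable
  have limK := ContDiffBump.ae_convolution_tendsto_right_of_locallyIntegrable
    (μ := volume) hφlim hφratio hK0.locallyIntegrable
  refine (ae_restrict_iff' hB).2 ?_
  filter_upwards [limv, limK] with x hxv hxK hxB
  rw [indicator_of_mem hxB] at hxv hxK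
  have hlarge : ∀ ρ < R, x ∈ Metric.ball x₀ ρ → ∫⁻ y in Metric.ball x₀ ρ, ‖v x - v y‖ₑ ≤
      ENNReal.ofReal ((2 * R) ^ n / n) * K x := by
    intro ρ hρ hxρ
    have hρ0 : 0 < ρ := Metric.pos_of_mem_ball hxρ
    set f : ℕ → EuclideanSpace ℝ (Fin n) → ℝ := fun k =>
      (φ k).normed volume ⋆[ContinuousLinearMap.lsmul ℝ ℝ, volume] (B.indicator v) with hf
    have hfc : ∀ k, Continuous (f k) := fun k =>
      ((φ k).hasCompactSupport_normed.contDiff_convolution_left (n := 0)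
        (ContinuousLinearMap.lsmul ℝ ℝ) (φ k).contDiff_normed hv0.locallyIntegrable).continuous
    have hptw : ∀ᵐ y ∂(volume.restrict (Metric.ball x₀ ρ)), ‖v x - v y‖ₑ =
        Filter.liminf (fun k => ‖f k x - f k y‖ₑ) Filter.atTop := by
      refine (ae_restrict_iff' Metric.isOpen_ball.measurableSet).2 (limv.mono fun y hy hyB => ?_)
      rw [indicator_of_mem (Metric.ball_subset_ball hρ.le hyB)] at hy
      exact ((hxv.sub hy).enorm).liminf_eq.symm
    have hbound : ∀ᶠ k in Filter.atTop, ∫⁻ y in Metric.ball x₀ ρ, ‖f k x - f k y‖ₑ ≤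
        ENNReal.ofReal ((2 * ρ) ^ n / n) * ENNReal.ofReal (((φ k).normed volume
          ⋆[ContinuousLinearMap.lsmul ℝ ℝ, volume] (B.indicator fun y => (K y).toReal)) x) := by
      filter_upwards [(tendsto_order.1 hφlim).2 (R - ρ) (by linarith)] with k hk
      have hs : tsupport ((φ k).normed volume) ⊆ Metric.closedBall 0 (φ k).rOut := by
        rw [(φ k).tsupport_normed_eq]
      rw [← lconvKernel_eq_ofReal_convolution (ε := (φ k).rOut) (by linarith) hKm hKfin
        (φ k).contDiff_normed (φ k).nonneg_normed hs hxρ]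
      exact lintegral_enorm_convolution_sub_le hn (ε := (φ k).rOut) (by linarith) hvi hhi hw hgm hg
        (φ k).contDiff_normed (φ k).nonneg_normed hs hxρ
    have hlim : Filter.Tendsto (fun k => ENNReal.ofReal ((2 * ρ) ^ n / n) *
        ENNReal.ofReal (((φ k).normed volume ⋆[ContinuousLinearMap.lsmul ℝ ℝ, volume]
          (B.indicator fun y => (K y).toReal)) x)) Filter.atTop
        (𝓝 (ENNReal.ofReal ((2 * ρ) ^ n / n) * ENNReal.ofReal (K x).toReal)) :=
      ENNReal.Tendsto.const_mul (ENNReal.tendsto_ofReal hxK) (Or.inr ENNReal.ofReal_ne_top)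
    calc ∫⁻ y in Metric.ball x₀ ρ, ‖v x - v y‖ₑ
        = ∫⁻ y in Metric.ball x₀ ρ, Filter.liminf (fun k => ‖f k x - f k y‖ₑ) Filter.atTop :=
          lintegral_congr_ae hptw
      _ ≤ Filter.liminf (fun k => ∫⁻ y in Metric.ball x₀ ρ, ‖f k x - f k y‖ₑ) Filter.atTop :=
          lintegral_liminf_le fun k => (continuous_const.sub (hfc k)).enorm.measurable
      _ ≤ _ := Filter.liminf_le_liminf hbound
      _ = ENNReal.ofReal ((2 * ρ) ^ n / n) * ENNReal.ofReal (K x).toReal := hlim.liminf_eq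
      _ ≤ _ := by
          gcongr
          exact ENNReal.ofReal_toReal_le
  refine lintegral_ball_le_of_forall_lt fun ρ hρ => ?_
  have hxd : dist x x₀ < R := hxB
  refine le_trans (lintegral_mono_set (Metric.ball_subset_ball (le_max_left ρ _)))
    (hlarge (max ρ ((dist x x₀ + R) / 2)) (max_lt hρ (by linarith)) ?_)
  rw [Metric.mem_ball]
  exact lt_max_of_lt_right (by linarith)

theorem IsBallWeight.integral_mul_eq_zero {n : ℕ} {x₀ : EuclideanSpace ℝ (Fin n)} {R : ℝ}
    (hR : 0 < R) {η v : EuclideanSpace ℝ (Fin n) → ℝ} (hη : IsBallWeight x₀ R η)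
    (h : weightedMean (Metric.ball x₀ R) η v = 0) : ∫ y in Metric.ball x₀ R, v y * η y = 0 := by
  rcases mul_eq_zero.1 h with h | h
  · exfalso
    have h1 : 0 < volume.real (Metric.ball x₀ (R / 2)) :=
      ENNReal.toReal_pos (Metric.measure_ball_pos _ _ (by linarith)).ne' measure_ball_lt_top.ne
    exact absurd (inv_eq_zero.1 h) (h1.trans_le hη.2.2).ne'
  · exact h

/-- A function with vanishing weighted mean is bounded almost everywhere by the Riesz potential of
its gradient. -/
theorem enorm_le_rieszPotential {n : ℕ} (hn : n ≠ 0) : ∃ C : ℝ≥0∞, C ≠ ⊤ ∧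
    ∀ (p : ℝ), 1 < p → ∀ (x₀ : EuclideanSpace ℝ (Fin n)) (R : ℝ), 0 < R →
    ∀ (η v : EuclideanSpace ℝ (Fin n) → ℝ) (h : Fin n → EuclideanSpace ℝ (Fin n) → ℝ),
      IsBallWeight x₀ R η → weightedMean (Metric.ball x₀ R) η v = 0 →
      MemLp v (ENNReal.ofReal p) (volume.restrict (Metric.ball x₀ R)) →
      (∀ i, MemLp (h i) (ENNReal.ofReal p) (volume.restrict (Metric.ball x₀ R))) →
      (∀ i, HasWeakDeriv (Metric.ball x₀ R) (Pi.single i 1) v (h i)) →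
      ∀ᵐ x ∂(volume.restrict (Metric.ball x₀ R)), ‖v x‖ₑ ≤ C *
        rieszPotential 1 ((Metric.ball x₀ R).indicator fun y => ∑ i, ‖h i y‖ₑ) x := by
  have hn0 : (0 : ℝ) < n := by exact_mod_cast Nat.pos_of_ne_zero hn
  set V := volume (Metric.ball (0 : EuclideanSpace ℝ (Fin n)) 1) with hV
  have hV0 : V ≠ 0 := (Metric.measure_ball_pos _ _ one_pos).ne'
  have hVt : V ≠ ⊤ := measure_ball_lt_top.ne
  refine ⟨V⁻¹ * ENNReal.ofReal (4 ^ n / n), ENNReal.mul_ne_top (ENNReal.inv_ne_top.2 hV0)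
    ENNReal.ofReal_ne_top, ?_⟩
  intro p hp x₀ R hR η v h hη hmean hv hh hw
  set B := Metric.ball x₀ R with hBdef
  have hfinB : IsFiniteMeasure (volume.restrict B) :=
    ⟨by rw [Measure.restrict_apply_univ]; exact measure_ball_lt_top⟩
  have hp1 : 1 ≤ ENNReal.ofReal p := by
    rw [← ENNReal.ofReal_one]
    exact ENNReal.ofReal_le_ofReal hp.le
  have hvi : Integrable v (volume.restrict B) := hv.integrable hp1
  have hzero := hη.integral_mul_eq_zero hR hmean
  have hηi : Integrable η (volume.restrict B) := hη.1.integrable le_top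
  have hvη : Integrable (fun y => v y * η y) (volume.restrict B) := by
    refine hvi.mul_bdd (c := 1) hη.1.1 (hη.2.1.mono fun y hy => ?_)
    rw [Real.norm_eq_abs, abs_le]
    exact ⟨by linarith [hy.1], hy.2⟩
  have hηabs : ∫ y in B, |η y| = ∫ y in B, η y :=
    integral_congr_ae (hη.2.1.mono fun y hy => abs_of_nonneg hy.1)
  filter_upwards [lintegral_enorm_sub_le_of_hasWeakDeriv hn hp hR hv hh hw] with x hx
  have e1 : v x * ∫ y in B, η y = ∫ y in B, (v x - v y) * η y := by
    simp_rw [sub_mul]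
    rw [integral_sub (hηi.const_mul _) hvη, hzero, sub_zero, integral_const_mul]
  have hvol : volume (Metric.ball x₀ (R / 2)) ≤ ‖∫ y in B, η y‖ₑ := by
    have h1 := hη.2.2
    rw [← hBdef, hηabs] at h1
    rw [← ofReal_measureReal measure_ball_lt_top.ne, Real.enorm_of_nonneg
      (measureReal_nonneg.trans h1)]
    exact ENNReal.ofReal_le_ofReal h1
  have e2 : ‖v x‖ₑ * volume (Metric.ball x₀ (R / 2)) ≤ ENNReal.ofReal ((2 * R) ^ n / n) *
        rieszPotential 1 (B.indicator fun y => ∑ i, ‖h i y‖ₑ) x := by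
    calc _ ≤ ‖v x‖ₑ * ‖∫ y in B, η y‖ₑ := by gcongr
      _ = ‖∫ y in B, (v x - v y) * η y‖ₑ := by rw [← enorm_mul, e1]
      _ ≤ ∫⁻ y in B, ‖(v x - v y) * η y‖ₑ := enorm_integral_le_lintegral_enorm _
      _ ≤ ∫⁻ y in B, ‖v x - v y‖ₑ := by
          refine lintegral_mono_ae (hη.2.1.mono fun y hy => ?_)
          rw [enorm_mul]
          refine mul_le_of_le_one_right zero_le ?_
          rw [Real.enorm_of_nonneg hy.1, ENNReal.ofReal_le_one]
          exact hy.2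
      _ ≤ _ := hx
  rw [Measure.addHaar_ball_of_pos _ _ (half_pos hR), finrank_euclideanSpace_fin, ← hV] at e2
  set P := rieszPotential 1 (B.indicator fun y => ∑ i, ‖h i y‖ₑ) x
  have hr0 : ENNReal.ofReal ((R / 2) ^ n) ≠ 0 := by
    rw [Ne, ENNReal.ofReal_eq_zero, not_le]
    positivity
  have hq : ENNReal.ofReal ((2 * R) ^ n / n) =
      ENNReal.ofReal ((R / 2) ^ n) * ENNReal.ofReal (4 ^ n / n) := by
    rw [← ENNReal.ofReal_mul (by positivity)]
    congr 1
    rw [← mul_div_assoc, ← mul_pow]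
    congr 2
    ring
  have hcancel : (ENNReal.ofReal ((R / 2) ^ n) * V) * ‖v x‖ₑ ≤
      (ENNReal.ofReal ((R / 2) ^ n) * V) * (V⁻¹ * ENNReal.ofReal (4 ^ n / n) * P) := by
    calc _ = ‖v x‖ₑ * (ENNReal.ofReal ((R / 2) ^ n) * V) := mul_comm _ _
      _ ≤ _ := e2
      _ = ENNReal.ofReal ((R / 2) ^ n) * (V * V⁻¹) * ENNReal.ofReal (4 ^ n / n) * P := by
          rw [hq, ENNReal.mul_inv_cancel hV0 hVt, mul_one]
      _ = _ := by ring
  exact (ENNReal.mul_le_mul_iff_right (mul_ne_zero hr0 hV0)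
    (ENNReal.mul_ne_top ENNReal.ofReal_ne_top hVt)).1 hcancel

/-! ### Iteration of the first-order estimate -/

theorem measurable_rieszPotential_indicator {n : ℕ} (s : ℝ) {B : Set (EuclideanSpace ℝ (Fin n))}
    (hB : MeasurableSet B) {f : EuclideanSpace ℝ (Fin n) → ℝ≥0∞}
    (hf : AEMeasurable f (volume.restrict B)) : Measurable (rieszPotential s (B.indicator f)) := by
  obtain ⟨g, hgm, hg⟩ := (aemeasurable_indicator_iff hB).2 hf
  rw [rieszPotential_congr_ae s hg]
  exact measurable_rieszPotential s hgm

/-- The intermediate exponent of the iteration: `1 / t` is `1 / p - m / n`, cut off from below so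
that `t` stays finite. -/
theorem exists_intermediate_exponent {n : ℕ} (hn : n ≠ 0) {p : ℝ} (hp : 1 < p) (m : ℕ) :
    ∃ t : ℝ, 1 < t ∧ 1 / p - m / n ≤ 1 / t ∧ ∀ s e : ℝ, 1 ≤ s → 1 ≤ e →
      1 / p - (m + e) / n ≤ 1 / s → 1 / t - e / n ≤ 1 / s := by
  have hn0 : (0 : ℝ) < n := by exact_mod_cast Nat.pos_of_ne_zero hn
  have hn1 : (1 : ℝ) ≤ n := by exact_mod_cast Nat.pos_of_ne_zero hn
  set M : ℝ := max (1 / p - m / n) (1 / (2 * n)) with hM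
  have hM0 : 0 < M := lt_max_of_lt_right (by positivity)
  have hM1 : M < 1 := by
    refine max_lt ?_ ?_
    · have h1 : 1 / p < 1 := (div_lt_one (by linarith)).2 hp
      have h2 : (0 : ℝ) ≤ m / n := by positivity
      linarith
    · rw [div_lt_one (by positivity)]
      linarith
  refine ⟨1 / M, (one_lt_div hM0).2 hM1, ?_, fun s e hs he h => ?_⟩
  · rw [one_div_one_div]
    exact le_max_left _ _
  · rw [one_div_one_div, sub_le_iff_le_add]
    refine max_le ?_ ?_
    · rw [add_div] at h
      linarith
    · have h1 : 1 / (2 * (n : ℝ)) ≤ 1 / n := by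
        gcongr
        linarith
      have h2 : 1 / (n : ℝ) ≤ e / n := by gcongr
      have h3 : 0 < 1 / s := by positivity
      linarith

/-- If each `V k` is dominated by the first-order potential of `V (k + 1)`, then `m` steps lead from
`L^p` to every `L^s` with `1 / s ≥ 1 / p - m / n`. -/
theorem eLpNorm'_le_of_rieszPotential_chain {n : ℕ} (hn : n ≠ 0) {p : ℝ} (hp : 1 < p) {D : ℝ≥0∞}
    (hD : D ≠ ⊤) (m : ℕ) : ∀ s : ℝ, 1 ≤ s → 1 / p - m / n ≤ 1 / s →
    ∃ C : ℝ≥0∞, C ≠ ⊤ ∧ ∀ (x₀ : EuclideanSpace ℝ (Fin n)) (R : ℝ), 0 < R →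
      ∀ V : ℕ → EuclideanSpace ℝ (Fin n) → ℝ≥0∞,
        (∀ k ≤ m, AEMeasurable (V k) (volume.restrict (Metric.ball x₀ R))) →
        (∀ k < m, ∀ᵐ x ∂(volume.restrict (Metric.ball x₀ R)), V k x ≤
          D * rieszPotential 1 ((Metric.ball x₀ R).indicator (V (k + 1))) x) →
        eLpNorm' (V 0) s (ballMeasure x₀ R) ≤
          C * ENNReal.ofReal (R ^ m) * eLpNorm' (V m) p (ballMeasure x₀ R) := by
  have hp0 : 0 < p := by linarith
  induction m with
  | zero =>
    intro s hs h
    refine ⟨1, by simp, fun x₀ R hR V hV _ => ?_⟩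
    have hprob := isProbabilityMeasure_ballMeasure x₀ hR
    have hsp : s ≤ p := by
      rw [← one_div_le_one_div hp0 (by linarith)]
      simpa using h
    simpa using eLpNorm'_le_eLpNorm'_of_exponent_le (by linarith) hsp _
      (aestronglyMeasurable_ballMeasure (hV 0 le_rfl))
  | succ m ih =>
    intro s hs h
    obtain ⟨t, ht, htp, hts⟩ := exists_intermediate_exponent hn hp m
    obtain ⟨C₁, hC₁, h₁⟩ := ih t ht.le htp
    obtain ⟨C₂, hC₂, h₂⟩ := eLpNorm'_ballMeasure_rieszPotential_le hn (s := 1) one_pos ht hs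
      (hts s 1 hs le_rfl (by simpa using h))
    refine ⟨D * C₂ * C₁, ENNReal.mul_ne_top (ENNReal.mul_ne_top hD hC₂) hC₁,
      fun x₀ R hR V hV hch => ?_⟩
    have i1 := h₁ x₀ R hR (fun k => V (k + 1)) (fun k hk => hV _ (by omega))
      (fun k hk => hch _ (by omega))
    have i2 := h₂ x₀ R hR (V 1) (hV 1 (by omega))
    calc eLpNorm' (V 0) s (ballMeasure x₀ R)
        ≤ D * eLpNorm' (rieszPotential 1 ((Metric.ball x₀ R).indicator (V 1))) s
            (ballMeasure x₀ R) := by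
          rw [← eLpNorm'_const_mul (by linarith) hD]
          exact eLpNorm'_mono_enorm_ae (by linarith) (ae_ballMeasure_iff.2 (hch 0 (by omega)))
      _ ≤ D * (C₂ * ENNReal.ofReal (R ^ (1 : ℝ)) * (C₁ * ENNReal.ofReal (R ^ m) *
            eLpNorm' (V (m + 1)) p (ballMeasure x₀ R))) := by
          gcongr
          exact i2.trans (mul_le_mul_right i1 _)
      _ = _ := by
          rw [Real.rpow_one, pow_succ, ENNReal.ofReal_mul (by positivity)]
          ring

/-- Moving the weight from the point `x` to the point `y` under the integral costs a second
potential, whose order is larger by `β`. -/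
theorem mul_rieszPotential_le {n : ℕ} {β : ℝ} (hβ : 0 < β) {B : Set (EuclideanSpace ℝ (Fin n))}
    (hB : MeasurableSet B) {A : ℝ≥0∞} (hA : A ≠ ⊤) {b f : EuclideanSpace ℝ (Fin n) → ℝ≥0∞}
    (hb : ∀ x ∈ B, ∀ y ∈ B, b x ≤ A * (b y + ENNReal.ofReal (‖x - y‖ ^ β)))
    (hbt : ∀ x, b x ≠ ⊤) (hbm : AEMeasurable b (volume.restrict B))
    (hf : AEMeasurable f (volume.restrict B)) {x : EuclideanSpace ℝ (Fin n)} (hx : x ∈ B) :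
    b x * rieszPotential 1 (B.indicator f) x ≤
      A * (rieszPotential 1 (B.indicator fun y => b y * f y) x +
        rieszPotential (1 + β) (B.indicator f) x) := by
  have hm : AEMeasurable (fun y => B.indicator (fun y => b y * f y) y *
      ENNReal.ofReal (‖x - y‖ ^ ((1 : ℝ) - n))) volume := by
    refine AEMeasurable.mul ((aemeasurable_indicator_iff hB).2 (hbm.mul hf)) ?_
    fun_prop
  rw [rieszPotential, rieszPotential, rieszPotential, ← lintegral_add_left' hm,
    ← lintegral_const_mul' _ _ (hbt x), ← lintegral_const_mul' _ _ hA]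
  refine lintegral_mono fun y => ?_
  by_cases hy : y ∈ B
  · simp only [indicator_of_mem hy]
    have hk : ENNReal.ofReal (‖x - y‖ ^ β) * ENNReal.ofReal (‖x - y‖ ^ ((1 : ℝ) - n)) ≤
        ENNReal.ofReal (‖x - y‖ ^ (1 + β - n)) := by
      rw [← ENNReal.ofReal_mul (by positivity)]
      refine ENNReal.ofReal_le_ofReal ?_
      rcases (norm_nonneg (x - y)).eq_or_lt with h0 | h0
      · rw [← h0, Real.zero_rpow hβ.ne', zero_mul]
        positivity
      · rw [← Real.rpow_add h0]
        refine le_of_eq ?_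
        congr 1
        ring
    calc b x * (f y * ENNReal.ofReal (‖x - y‖ ^ ((1 : ℝ) - n)))
        ≤ A * (b y + ENNReal.ofReal (‖x - y‖ ^ β)) *
          (f y * ENNReal.ofReal (‖x - y‖ ^ ((1 : ℝ) - n))) := by
          gcongr
          exact hb x hx y hy
      _ = A * (b y * f y * ENNReal.ofReal (‖x - y‖ ^ ((1 : ℝ) - n)) + f y *
          (ENNReal.ofReal (‖x - y‖ ^ β) * ENNReal.ofReal (‖x - y‖ ^ ((1 : ℝ) - n)))) := by ring
      _ ≤ _ := by gcongr
  · simp [hy]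

/-- The weighted form of the iteration. The weight `b`, which stands for `a^(1/q)`, moves along the
chain; the error terms of order `β`, which stands for `α/q`, are controlled by the unweighted chain
starting from `L^p`. -/
theorem eLpNorm'_weight_mul_le_of_rieszPotential_chain {n : ℕ} (hn : n ≠ 0) {p q β : ℝ} (hp : 1 < p)
    (hq : 1 < q) (hβ : 0 < β) (hpq : 1 / p - β / n ≤ 1 / q) {D A : ℝ≥0∞} (hD : D ≠ ⊤) (hA : A ≠ ⊤)
    (m : ℕ) : ∀ r : ℝ, 1 ≤ r → 1 / q - m / n ≤ 1 / r →
    ∃ C : ℝ≥0∞, C ≠ ⊤ ∧ ∀ (x₀ : EuclideanSpace ℝ (Fin n)) (R : ℝ), 0 < R →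
      ∀ (b : EuclideanSpace ℝ (Fin n) → ℝ≥0∞) (V : ℕ → EuclideanSpace ℝ (Fin n) → ℝ≥0∞),
        (∀ x ∈ Metric.ball x₀ R, ∀ y ∈ Metric.ball x₀ R,
          b x ≤ A * (b y + ENNReal.ofReal (‖x - y‖ ^ β))) → (∀ x, b x ≠ ⊤) →
        AEMeasurable b (volume.restrict (Metric.ball x₀ R)) →
        (∀ k ≤ m, AEMeasurable (V k) (volume.restrict (Metric.ball x₀ R))) →
        (∀ k < m, ∀ᵐ x ∂(volume.restrict (Metric.ball x₀ R)), V k x ≤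
          D * rieszPotential 1 ((Metric.ball x₀ R).indicator (V (k + 1))) x) →
        eLpNorm' (fun x => b x * V 0 x) r (ballMeasure x₀ R) ≤
          C * ENNReal.ofReal (R ^ m) * (eLpNorm' (fun x => b x * V m x) q (ballMeasure x₀ R) +
            ENNReal.ofReal (R ^ β) * eLpNorm' (V m) p (ballMeasure x₀ R)) := by
  have hq0 : 0 < q := by linarith
  have hn0 : (0 : ℝ) < n := by exact_mod_cast Nat.pos_of_ne_zero hn
  induction m with
  | zero =>
    intro r hr h
    refine ⟨1, by simp, fun x₀ R hR b V _ _ hbm hV _ => ?_⟩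
    have hprob := isProbabilityMeasure_ballMeasure x₀ hR
    have hrq : r ≤ q := by
      rw [← one_div_le_one_div hq0 (by linarith)]
      simpa using h
    have : eLpNorm' (fun x => b x * V 0 x) r (ballMeasure x₀ R) ≤
        eLpNorm' (fun x => b x * V 0 x) q (ballMeasure x₀ R) :=
      eLpNorm'_le_eLpNorm'_of_exponent_le (by linarith) hrq _
        (aestronglyMeasurable_ballMeasure (hbm.mul (hV 0 le_rfl)))
    simpa using this.trans le_self_add
  | succ m ih =>
    intro r hr h
    have hr0 : 0 < r := by linarith
    obtain ⟨t, ht, htq, htr⟩ := exists_intermediate_exponent hn hq m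
    obtain ⟨τ, hτ, hτp, hτr⟩ := exists_intermediate_exponent hn hp m
    obtain ⟨C₁, hC₁, h₁⟩ := ih t ht.le htq
    obtain ⟨C₂, hC₂, h₂⟩ := eLpNorm'_ballMeasure_rieszPotential_le hn (s := 1) one_pos ht hr
      (htr r 1 hr le_rfl (by simpa using h))
    obtain ⟨C₃, hC₃, h₃⟩ := eLpNorm'_le_of_rieszPotential_chain hn hp hD m τ hτ.le hτp
    -- This is where the relation between `p`, `q` and `β` enters.
    obtain ⟨C₄, hC₄, h₄⟩ := eLpNorm'_ballMeasure_rieszPotential_le hn (s := 1 + β) (by linarith) hτ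
      hr (hτr r (1 + β) hr (by linarith) (by
        refine le_trans ?_ h
        push_cast
        rw [← add_assoc, add_div ((m : ℝ) + 1)]
        linarith))
    refine ⟨D * A * (C₂ * C₁ + C₄ * C₃), ENNReal.mul_ne_top (ENNReal.mul_ne_top hD hA)
      (ENNReal.add_ne_top.2 ⟨ENNReal.mul_ne_top hC₂ hC₁, ENNReal.mul_ne_top hC₄ hC₃⟩),
      fun x₀ R hR b V hb hbt hbm hV hch => ?_⟩
    have hB : MeasurableSet (Metric.ball x₀ R) := Metric.isOpen_ball.measurableSet
    have i1 := h₁ x₀ R hR b (fun k => V (k + 1)) hb hbt hbm (fun k hk => hV _ (by omega))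
      (fun k hk => hch _ (by omega))
    have i2 := h₂ x₀ R hR (fun y => b y * V 1 y) (hbm.mul (hV 1 (by omega)))
    have i3 := h₃ x₀ R hR (fun k => V (k + 1)) (fun k hk => hV _ (by omega))
      (fun k hk => hch _ (by omega))
    have i4 := h₄ x₀ R hR (V 1) (hV 1 (by omega))
    set μ := ballMeasure x₀ R
    set X := eLpNorm' (fun x => b x * V (m + 1) x) q μ
    set Y := eLpNorm' (V (m + 1)) p μ
    set I₁ := rieszPotential 1 ((Metric.ball x₀ R).indicator fun y => b y * V 1 y)
    set I₂ := rieszPotential (1 + β) ((Metric.ball x₀ R).indicator (V 1))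
    have hpt : ∀ᵐ x ∂μ, b x * V 0 x ≤ (D * A) * (I₁ + I₂) x := by
      refine ae_ballMeasure_iff.2 ?_
      filter_upwards [hch 0 (by omega), ae_restrict_mem hB] with x hx hxB
      calc b x * V 0 x
          ≤ b x * (D * rieszPotential 1 ((Metric.ball x₀ R).indicator (V 1)) x) := by
            gcongr
        _ = D * (b x * rieszPotential 1 ((Metric.ball x₀ R).indicator (V 1)) x) := by ring
        _ ≤ D * (A * (I₁ x + I₂ x)) := by
            exact mul_le_mul_right
              (mul_rieszPotential_le hβ hB hA hb hbt hbm (hV 1 (by omega)) hxB) _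
        _ = _ := by rw [Pi.add_apply, mul_assoc]
    calc eLpNorm' (fun x => b x * V 0 x) r μ
        ≤ D * A * eLpNorm' (I₁ + I₂) r μ := by
          rw [← eLpNorm'_const_mul hr0 (ENNReal.mul_ne_top hD hA)]
          exact eLpNorm'_mono_enorm_ae hr0.le hpt
      _ ≤ D * A * (eLpNorm' I₁ r μ + eLpNorm' I₂ r μ) := by
          gcongr
          exact eLpNorm'_add_le
            (measurable_rieszPotential_indicator _ hB
              (hbm.mul (hV 1 (by omega)))).aestronglyMeasurable
            (measurable_rieszPotential_indicator _ hB (hV 1 (by omega))).aestronglyMeasurable hr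
      _ ≤ D * A * (C₂ * ENNReal.ofReal (R ^ (1 : ℝ)) * (C₁ * ENNReal.ofReal (R ^ m) *
            (X + ENNReal.ofReal (R ^ β) * Y)) +
            C₄ * ENNReal.ofReal (R ^ (1 + β)) * (C₃ * ENNReal.ofReal (R ^ m) * Y)) := by
          refine mul_le_mul_right (add_le_add ?_ ?_) _
          · exact i2.trans (mul_le_mul_right i1 _)
          · exact i4.trans (mul_le_mul_right i3 _)
      _ = D * A * (C₂ * C₁ * ENNReal.ofReal (R ^ (m + 1)) * (X + ENNReal.ofReal (R ^ β) * Y) +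
            C₄ * C₃ * ENNReal.ofReal (R ^ (m + 1)) * (ENNReal.ofReal (R ^ β) * Y)) := by
          rw [Real.rpow_add hR, Real.rpow_one, pow_succ, ENNReal.ofReal_mul (by positivity),
            ENNReal.ofReal_mul (by positivity)]
          ring
      _ ≤ D * A * (C₂ * C₁ * ENNReal.ofReal (R ^ (m + 1)) * (X + ENNReal.ofReal (R ^ β) * Y) +
            C₄ * C₃ * ENNReal.ofReal (R ^ (m + 1)) * (X + ENNReal.ofReal (R ^ β) * Y)) := by
          gcongr
          exact le_add_self
      _ = _ := by ring

/-! ### The arrays of weak derivatives and the final estimate -/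

/-- The `ℓ¹` norm of the array of all weak derivatives of order `k`. It is comparable to `normD` and,
being additive, passes through potentials and `L^p` norms more easily. -/
noncomputable def gradSum {n : ℕ} (Ω : Set (EuclideanSpace ℝ (Fin n))) (k : ℕ)
    (u : EuclideanSpace ℝ (Fin n) → ℝ) (x : EuclideanSpace ℝ (Fin n)) : ℝ≥0∞ :=
  ∑ σ ∈ Finset.piAntidiag (Finset.univ : Finset (Fin n)) k, ‖weakDeriv Ω σ u x‖ₑ

theorem mem_piAntidiag_univ {n k : ℕ} {σ : Fin n → ℕ} :
    σ ∈ Finset.piAntidiag (Finset.univ : Finset (Fin n)) k ↔ ∑ i, σ i = k := by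
  simp [Finset.mem_piAntidiag]

theorem gradSum_zero {n : ℕ} (Ω : Set (EuclideanSpace ℝ (Fin n)))
    (u : EuclideanSpace ℝ (Fin n) → ℝ) (x : EuclideanSpace ℝ (Fin n)) :
    gradSum Ω 0 u x = ‖weakDeriv Ω 0 u x‖ₑ := by
  rw [gradSum, Finset.piAntidiag_zero, Finset.sum_singleton]

theorem gradSum_le_normD {n : ℕ} (Ω : Set (EuclideanSpace ℝ (Fin n))) (k : ℕ)
    (u : EuclideanSpace ℝ (Fin n) → ℝ) (x : EuclideanSpace ℝ (Fin n)) :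
    gradSum Ω k u x ≤ (Finset.piAntidiag (Finset.univ : Finset (Fin n)) k).card *
      ENNReal.ofReal (normD Ω k u x) := by
  rw [← nsmul_eq_mul]
  refine Finset.sum_le_card_nsmul _ _ _ fun σ hσ => ?_
  rw [Real.enorm_eq_ofReal_abs]
  refine ENNReal.ofReal_le_ofReal (Real.abs_le_sqrt ?_)
  exact Finset.single_le_sum (f := fun σ => weakDeriv Ω σ u x ^ 2) (fun _ _ => sq_nonneg _) hσ

theorem aemeasurable_gradSum {n ℓ k : ℕ} {p : ℝ≥0∞} {Ω : Set (EuclideanSpace ℝ (Fin n))}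
    (hΩ : IsOpen Ω) {u : EuclideanSpace ℝ (Fin n) → ℝ} (h : MemSobolev ℓ p Ω u) (hk : k ≤ ℓ) :
    AEMeasurable (gradSum Ω k u) (volume.restrict Ω) := by
  refine Finset.aemeasurable_fun_sum _ fun σ hσ => ?_
  exact (h.memLp_weakDeriv hΩ ((mem_piAntidiag_univ.1 hσ).trans_le hk)).1.enorm

/-- The pointwise bound applied to all derivatives of order `k` at once. -/
theorem gradSum_le_rieszPotential {n : ℕ} (hn : n ≠ 0) (k : ℕ) : ∃ C : ℝ≥0∞, C ≠ ⊤ ∧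
    ∀ (p : ℝ), 1 < p → ∀ (ℓ : ℕ), k < ℓ → ∀ (x₀ : EuclideanSpace ℝ (Fin n)) (R : ℝ), 0 < R →
    ∀ (η u : EuclideanSpace ℝ (Fin n) → ℝ), IsBallWeight x₀ R η →
      MemSobolev ℓ (ENNReal.ofReal p) (Metric.ball x₀ R) u →
      (∀ σ : Fin n → ℕ, ∑ i, σ i = k →
        weightedMean (Metric.ball x₀ R) η (weakDeriv (Metric.ball x₀ R) σ u) = 0) →
      ∀ᵐ x ∂(volume.restrict (Metric.ball x₀ R)), gradSum (Metric.ball x₀ R) k u x ≤ C *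
        rieszPotential 1 ((Metric.ball x₀ R).indicator (gradSum (Metric.ball x₀ R) (k + 1) u))
          x := by
  obtain ⟨C, hC, hrep⟩ := enorm_le_rieszPotential hn
  refine ⟨(Finset.piAntidiag (Finset.univ : Finset (Fin n)) k).card * (C * n),
    ENNReal.mul_ne_top (by simp) (ENNReal.mul_ne_top hC (by simp)), ?_⟩
  intro p hp ℓ hk x₀ R hR η u hη hu hmean
  set B := Metric.ball x₀ R with hB
  have hBo : IsOpen B := Metric.isOpen_ball
  have hσ : ∀ σ ∈ Finset.piAntidiag (Finset.univ : Finset (Fin n)) k,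
      ∀ᵐ x ∂(volume.restrict B), ‖weakDeriv B σ u x‖ₑ ≤ C * n *
        rieszPotential 1 (B.indicator (gradSum B (k + 1) u)) x := by
    intro σ hσ
    rw [mem_piAntidiag_univ] at hσ
    have hle : ∀ i : Fin n, ∑ j, (σ + Pi.single i 1 : Fin n → ℕ) j = k + 1 := fun i => by
      rw [sum_add_single, hσ]
    filter_upwards [hrep p hp x₀ R hR η (weakDeriv B σ u)
      (fun i => weakDeriv B (σ + Pi.single i 1) u) hη (hmean σ hσ)
      (hu.memLp_weakDeriv hBo (by omega)) (fun i => hu.memLp_weakDeriv hBo (by rw [hle i]; omega))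
      (fun i => (hu.hasWeakDeriv (by omega)).single (hu.hasWeakDeriv (by rw [hle i]; omega)))]
      with x hx
    refine hx.trans ?_
    rw [mul_assoc]
    gcongr
    rw [rieszPotential, rieszPotential, ← lintegral_const_mul' _ _ (by simp)]
    refine lintegral_mono fun y => ?_
    rw [← mul_assoc]
    gcongr
    by_cases hy : y ∈ B
    · rw [indicator_of_mem hy, indicator_of_mem hy]
      calc ∑ i : Fin n, ‖weakDeriv B (σ + Pi.single i 1) u y‖ₑ
          ≤ ∑ _i : Fin n, gradSum B (k + 1) u y := by
            refine Finset.sum_le_sum fun i _ => ?_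
            exact Finset.single_le_sum (f := fun σ => ‖weakDeriv B σ u y‖ₑ)
              (fun _ _ => zero_le) (mem_piAntidiag_univ.2 (hle i))
        _ = _ := by simp
    · simp [hy, ← hB]
  have hall := (Finset.eventually_all _).2 hσ
  filter_upwards [hall] with x hx
  calc gradSum B k u x ≤ (Finset.piAntidiag (Finset.univ : Finset (Fin n)) k).card • (C * n *
        rieszPotential 1 (B.indicator (gradSum B (k + 1) u)) x) :=
        Finset.sum_le_card_nsmul _ _ _ hx
    _ = _ := by
        rw [nsmul_eq_mul]
        ring

/-- The infimum `[a]_α` need not be an admissible constant, but `[a]_α + 1` is. -/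
theorem rpow_ofReal_le_of_zSeminorm {n : ℕ} {α A q : ℝ} (hq : 1 ≤ q)
    {Ω : Set (EuclideanSpace ℝ (Fin n))} {a : EuclideanSpace ℝ (Fin n) → ℝ}
    (ha : MemZ α Ω a) (hA : zSeminorm α Ω a = A) {x y : EuclideanSpace ℝ (Fin n)}
    (hx : x ∈ Ω) (hy : y ∈ Ω) :
    ENNReal.ofReal (a x) ^ (1 / q) ≤ ENNReal.ofReal (A + 1) ^ (1 / q) *
      (ENNReal.ofReal (a y) ^ (1 / q) + ENNReal.ofReal (‖x - y‖ ^ (α / q))) := by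
  obtain ⟨_, ha0, hne⟩ := ha
  obtain ⟨C, ⟨hC0, hC⟩, hCA⟩ := exists_lt_of_csInf_lt hne
    (show sInf (zConstants α Ω a) < A + 1 by
      rw [← hA]
      exact lt_add_one _)
  have hq0 : 0 < q := by linarith
  have hd : 0 ≤ ‖x - y‖ ^ α := by positivity
  have h1 : a x ≤ (A + 1) * (a y + ‖x - y‖ ^ α) :=
    (hC x hx y hy).trans (mul_le_mul_of_nonneg_right hCA.le (add_nonneg (ha0 y hy) hd))
  have h2 : ENNReal.ofReal (‖x - y‖ ^ (α / q)) = ENNReal.ofReal (‖x - y‖ ^ α) ^ (1 / q) := by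
    rw [ENNReal.ofReal_rpow_of_nonneg hd (by positivity), ← Real.rpow_mul (norm_nonneg _),
      mul_one_div]
  calc _ ≤ ENNReal.ofReal ((A + 1) * (a y + ‖x - y‖ ^ α)) ^ (1 / q) := by gcongr
    _ = ENNReal.ofReal (A + 1) ^ (1 / q) *
        (ENNReal.ofReal (a y) + ENNReal.ofReal (‖x - y‖ ^ α)) ^ (1 / q) := by
        rw [ENNReal.ofReal_mul (by linarith), ENNReal.mul_rpow_of_nonneg _ _ (by positivity),
          ENNReal.ofReal_add (ha0 y hy) hd]
    _ ≤ _ := by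
        rw [h2]
        gcongr
        refine ENNReal.rpow_add_le_add_rpow _ _ (by positivity) ?_
        rw [div_le_one hq0]
        exact hq

theorem rpow_setLAverage_eq_eLpNorm' {n : ℕ} {x₀ : EuclideanSpace ℝ (Fin n)} {R r : ℝ}
    {F f : EuclideanSpace ℝ (Fin n) → ℝ≥0∞}
    (h : ∀ᵐ x ∂(volume.restrict (Metric.ball x₀ R)), F x = f x ^ r) :
    (⨍⁻ x in Metric.ball x₀ R, F x ∂volume) ^ (1 / r) = eLpNorm' f r (ballMeasure x₀ R) := by
  rw [eLpNorm'_eq_lintegral_enorm, setLAverage_eq']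
  congr 1
  refine lintegral_congr_ae (ae_ballMeasure_iff.2 ?_)
  simpa using h

/-- The estimate for all admissible exponents, with admissibility written as
`1 / q - ℓ / n ≤ 1 / r`. -/
theorem weighted_sobolev_poincare {n : ℕ} (hn : n ≠ 0) {p q α : ℝ} (A : ℝ) (hp : 1 < p)
    (hpq : p ≤ q) (hα : 0 < α) (hqp : q / p ≤ 1 + α / n) (ℓ : ℕ) {r : ℝ} (hr : 1 ≤ r)
    (hadm : 1 / q - ℓ / n ≤ 1 / r) :
    ∃ c : ℝ, 0 < c ∧
      ∀ (x₀ : EuclideanSpace ℝ (Fin n)) (R : ℝ) (a η u : EuclideanSpace ℝ (Fin n) → ℝ),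
        0 < R →
        MemZ α (Metric.ball x₀ R) a →
        zSeminorm α (Metric.ball x₀ R) a = A →
        IsBallWeight x₀ R η →
        MemSobolev ℓ (ENNReal.ofReal p) (Metric.ball x₀ R) u →
        (∀ σ : Fin n → ℕ, ∑ i, σ i < ℓ →
          weightedMean (Metric.ball x₀ R) η (weakDeriv (Metric.ball x₀ R) σ u) = 0) →
        (⨍⁻ x in Metric.ball x₀ R,
            ENNReal.ofReal (a x ^ (r / q) * |u x / R ^ ℓ| ^ r) ∂volume) ^ (1 / r) ≤
          ENNReal.ofReal c *
            (⨍⁻ x in Metric.ball x₀ R,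
              ENNReal.ofReal (a x * normD (Metric.ball x₀ R) ℓ u x ^ q) ∂volume) ^ (1 / q) +
          ENNReal.ofReal c * ENNReal.ofReal (R ^ (α / q)) *
            (⨍⁻ x in Metric.ball x₀ R,
              ENNReal.ofReal (normD (Metric.ball x₀ R) ℓ u x ^ p) ∂volume) ^ (1 / p) := by
  have hn0 : (0 : ℝ) < n := by exact_mod_cast Nat.pos_of_ne_zero hn
  have hp0 : 0 < p := by linarith
  have hq : 1 < q := by linarith
  have hq0 : 0 < q := by linarith
  have hr0 : 0 < r := by linarith
  have hβ : 0 < α / q := by positivity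
  have hexp : 1 / p - α / q / n ≤ 1 / q := by
    have : 1 / p = q / p / q := by field_simp
    have h2 : q / p / q ≤ (1 + α / n) / q := by gcongr
    have h3 : (1 + α / n) / q = 1 / q + α / q / n := by ring
    linarith
  choose C hC hchain using fun k : ℕ => gradSum_le_rieszPotential hn k
  set D : ℝ≥0∞ := ∑ k ∈ Finset.range ℓ, C k with hDdef
  have hD : D ≠ ⊤ := ENNReal.sum_ne_top.2 fun k _ => hC k
  set A' : ℝ≥0∞ := ENNReal.ofReal (A + 1) ^ (1 / q) with hA'
  have hA't : A' ≠ ⊤ := ENNReal.rpow_ne_top_of_nonneg (by positivity) ENNReal.ofReal_ne_top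
  obtain ⟨C₀, hC₀, hmain⟩ := eLpNorm'_weight_mul_le_of_rieszPotential_chain hn hp hq hβ hexp
    hD hA't ℓ r hr hadm
  set N : ℝ≥0∞ := ((Finset.piAntidiag (Finset.univ : Finset (Fin n)) ℓ).card : ℝ≥0∞) with hN
  have hNt : N ≠ ⊤ := by simp [hN]
  refine ⟨(C₀ * N).toReal + 1, by positivity, fun x₀ R a η u hR ha haA hη hu hmean => ?_⟩
  have hB : MeasurableSet (Metric.ball x₀ R) := Metric.isOpen_ball.measurableSet
  set b : EuclideanSpace ℝ (Fin n) → ℝ≥0∞ := fun x => ENNReal.ofReal (a x) ^ (1 / q) with hb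
  set V : ℕ → EuclideanSpace ℝ (Fin n) → ℝ≥0∞ := fun k => gradSum (Metric.ball x₀ R) k u with hV
  set W : EuclideanSpace ℝ (Fin n) → ℝ≥0∞ := fun x =>
    ENNReal.ofReal (normD (Metric.ball x₀ R) ℓ u x) with hW
  have key := hmain x₀ R hR b V
    (fun x hx y hy => rpow_ofReal_le_of_zSeminorm hq.le ha haA hx hy)
    (fun x => ENNReal.rpow_ne_top_of_nonneg (by positivity) ENNReal.ofReal_ne_top)
    (ha.1.ennreal_ofReal.pow_const _)
    (fun k hk => aemeasurable_gradSum Metric.isOpen_ball hu hk)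
    (fun k hk => by
      filter_upwards [hchain k p hp ℓ hk x₀ R hR η u hη hu
        (fun σ hσ => hmean σ (by omega))] with x hx
      refine hx.trans (mul_le_mul_left ?_ _)
      exact Finset.single_le_sum (f := C) (fun _ _ => zero_le) (Finset.mem_range.2 hk))
  have hnormD : ∀ x, 0 ≤ normD (Metric.ball x₀ R) ℓ u x := fun x => Real.sqrt_nonneg _
  have hRℓ : ENNReal.ofReal (R ^ ℓ) ≠ 0 := by
    rw [Ne, ENNReal.ofReal_eq_zero, not_le]
    positivity
  have eL : (⨍⁻ x in Metric.ball x₀ R,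
      ENNReal.ofReal (a x ^ (r / q) * |u x / R ^ ℓ| ^ r) ∂volume) ^ (1 / r) =
      (ENNReal.ofReal (R ^ ℓ))⁻¹ * eLpNorm' (fun x => b x * V 0 x) r (ballMeasure x₀ R) := by
    rw [← eLpNorm'_const_mul hr0 (ENNReal.inv_ne_top.2 hRℓ)]
    refine rpow_setLAverage_eq_eLpNorm' ?_
    filter_upwards [hu.weakDeriv_zero_ae_eq Metric.isOpen_ball, ae_restrict_mem hB] with x hx hxB
    have hax := ha.2.1 x hxB
    simp only [hb, hV]
    rw [gradSum_zero, hx, Real.enorm_eq_ofReal_abs, ← ENNReal.ofReal_inv_of_pos (by positivity),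
      ENNReal.ofReal_rpow_of_nonneg hax (by positivity), ← ENNReal.ofReal_mul (by positivity),
      ← ENNReal.ofReal_mul (by positivity), ENNReal.ofReal_rpow_of_nonneg (by positivity) hr0.le]
    congr 1
    rw [mul_left_comm, Real.mul_rpow (by positivity) (by positivity), ← Real.rpow_mul hax,
      one_div_mul_eq_div, abs_div, abs_of_pos (pow_pos hR ℓ), div_eq_inv_mul |u x|]
  have eX : (⨍⁻ x in Metric.ball x₀ R,
      ENNReal.ofReal (a x * normD (Metric.ball x₀ R) ℓ u x ^ q) ∂volume) ^ (1 / q) =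
      eLpNorm' (fun x => b x * W x) q (ballMeasure x₀ R) := by
    refine rpow_setLAverage_eq_eLpNorm' ?_
    filter_upwards [ae_restrict_mem hB] with x hxB
    have hax := ha.2.1 x hxB
    simp only [hb, hW]
    rw [ENNReal.mul_rpow_of_nonneg _ _ hq0.le, ← ENNReal.rpow_mul, one_div_mul_cancel hq0.ne',
      ENNReal.rpow_one, ENNReal.ofReal_rpow_of_nonneg (hnormD x) hq0.le, ENNReal.ofReal_mul hax]
  have eY : (⨍⁻ x in Metric.ball x₀ R,
      ENNReal.ofReal (normD (Metric.ball x₀ R) ℓ u x ^ p) ∂volume) ^ (1 / p) =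
      eLpNorm' W p (ballMeasure x₀ R) := by
    refine rpow_setLAverage_eq_eLpNorm' (Filter.Eventually.of_forall fun x => ?_)
    rw [ENNReal.ofReal_rpow_of_nonneg (hnormD x) hp0.le]
  rw [eL, eX, eY]
  set μ := ballMeasure x₀ R
  have hX : eLpNorm' (fun x => b x * V ℓ x) q μ ≤ N * eLpNorm' (fun x => b x * W x) q μ := by
    rw [← eLpNorm'_const_mul hq0 hNt]
    refine eLpNorm'_mono_enorm_ae hq0.le (Filter.Eventually.of_forall fun x => ?_)
    rw [enorm_eq_self, enorm_eq_self, mul_left_comm]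
    gcongr
    exact gradSum_le_normD _ _ _ _
  have hY : eLpNorm' (V ℓ) p μ ≤ N * eLpNorm' W p μ := by
    rw [← eLpNorm'_const_mul hp0 hNt]
    refine eLpNorm'_mono_enorm_ae hp0.le (Filter.Eventually.of_forall fun x => ?_)
    exact gradSum_le_normD _ _ _ _
  have hc : C₀ * N ≤ ENNReal.ofReal ((C₀ * N).toReal + 1) := by
    rw [ENNReal.ofReal_add ENNReal.toReal_nonneg zero_le_one,
      ENNReal.ofReal_toReal (ENNReal.mul_ne_top hC₀ hNt)]
    exact le_self_add
  calc (ENNReal.ofReal (R ^ ℓ))⁻¹ * eLpNorm' (fun x => b x * V 0 x) r μ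
      ≤ (ENNReal.ofReal (R ^ ℓ))⁻¹ * (C₀ * ENNReal.ofReal (R ^ ℓ) *
        (N * eLpNorm' (fun x => b x * W x) q μ +
          ENNReal.ofReal (R ^ (α / q)) * (N * eLpNorm' W p μ))) := by
        refine mul_le_mul_right (key.trans (mul_le_mul_right (add_le_add hX ?_) _)) _
        exact mul_le_mul_right hY _
    _ = ((ENNReal.ofReal (R ^ ℓ))⁻¹ * ENNReal.ofReal (R ^ ℓ)) * ((C₀ * N) *
        (eLpNorm' (fun x => b x * W x) q μ + ENNReal.ofReal (R ^ (α / q)) * eLpNorm' W p μ)) := by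
        ring
    _ = (C₀ * N) *
        (eLpNorm' (fun x => b x * W x) q μ + ENNReal.ofReal (R ^ (α / q)) * eLpNorm' W p μ) := by
        rw [ENNReal.inv_mul_cancel hRℓ ENNReal.ofReal_ne_top, one_mul]
    _ ≤ ENNReal.ofReal ((C₀ * N).toReal + 1) *
        (eLpNorm' (fun x => b x * W x) q μ + ENNReal.ofReal (R ^ (α / q)) * eLpNorm' W p μ) := by
        gcongr
    _ = _ := by ring

theorem corollary3p7 (n : ℕ) (hn : 2 ≤ n) (p q α A : ℝ) (hp : 1 < p) (hpq : p ≤ q) (hα : 0 < α)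
    (hqp : q / p ≤ 1 + α / n) :
    (∀ (ℓ : ℕ) (r : ℝ), 1 ≤ r →
      (((ℓ : ℝ) * q < n ∧ ENNReal.ofReal r ≤ sobolevExponent n ℓ q) ∨
        ((n : ℝ) ≤ ℓ * q ∧ ENNReal.ofReal r < sobolevExponent n ℓ q)) →
      ∃ c : ℝ, 0 < c ∧
        ∀ (x₀ : EuclideanSpace ℝ (Fin n)) (R : ℝ) (a η u : EuclideanSpace ℝ (Fin n) → ℝ),
          0 < R →
          MemZ α (Metric.ball x₀ R) a →
          zSeminorm α (Metric.ball x₀ R) a = A →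
          IsBallWeight x₀ R η →
          MemSobolev ℓ (ENNReal.ofReal p) (Metric.ball x₀ R) u →
          ∫⁻ x in Metric.ball x₀ R,
            ENNReal.ofReal (a x * normD (Metric.ball x₀ R) ℓ u x ^ q) < ⊤ →
          (∀ σ : Fin n → ℕ, ∑ i, σ i < ℓ →
            weightedMean (Metric.ball x₀ R) η (weakDeriv (Metric.ball x₀ R) σ u) = 0) →
          (⨍⁻ x in Metric.ball x₀ R,
              ENNReal.ofReal (a x ^ (r / q) * |u x / R ^ ℓ| ^ r) ∂volume) ^ (1 / r) ≤
            ENNReal.ofReal c *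
              (⨍⁻ x in Metric.ball x₀ R,
                ENNReal.ofReal (a x * normD (Metric.ball x₀ R) ℓ u x ^ q) ∂volume) ^ (1 / q) +
            ENNReal.ofReal c * ENNReal.ofReal (R ^ (α / q)) *
              (⨍⁻ x in Metric.ball x₀ R,
                ENNReal.ofReal (normD (Metric.ball x₀ R) ℓ u x ^ p) ∂volume) ^ (1 / p)) ∧
    (∃ c : ℝ, 0 < c ∧
      ∀ (x₀ : EuclideanSpace ℝ (Fin n)) (R : ℝ) (a η u : EuclideanSpace ℝ (Fin n) → ℝ),
        0 < R →
        MemZ α (Metric.ball x₀ R) a →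
        zSeminorm α (Metric.ball x₀ R) a = A →
        IsBallWeight x₀ R η →
        MemSobolev 1 (ENNReal.ofReal p) (Metric.ball x₀ R) u →
        ∫⁻ x in Metric.ball x₀ R,
          ENNReal.ofReal (a x * normD (Metric.ball x₀ R) 1 u x ^ q) < ⊤ →
        weightedMean (Metric.ball x₀ R) η u = 0 →
        (⨍⁻ x in Metric.ball x₀ R, ENNReal.ofReal (a x * |u x / R| ^ q) ∂volume) ^ (1 / q) ≤
          ENNReal.ofReal c *
            (⨍⁻ x in Metric.ball x₀ R,
              ENNReal.ofReal (a x * normD (Metric.ball x₀ R) 1 u x ^ q) ∂volume) ^ (1 / q) +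
          ENNReal.ofReal c * ENNReal.ofReal (R ^ (α / q)) *
            (⨍⁻ x in Metric.ball x₀ R,
              ENNReal.ofReal (normD (Metric.ball x₀ R) 1 u x ^ p) ∂volume) ^ (1 / p)) := by
  have hn' : n ≠ 0 := by omega
  have hn0 : (0 : ℝ) < n := by exact_mod_cast Nat.pos_of_ne_zero hn'
  have hq0 : 0 < q := by linarith
  refine ⟨fun ℓ r hr hadm => ?_, ?_⟩
  · have hr0 : 0 < r := by linarith
    have hexp : 1 / q - ℓ / n ≤ 1 / r := by
      rcases hadm with ⟨hlt, hle⟩ | ⟨hge, _⟩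
      · have hd : 0 < (n : ℝ) - ℓ * q := by linarith
        rw [sobolevExponent, if_pos hlt, ENNReal.ofReal_le_ofReal_iff (by positivity)] at hle
        have h1 : 1 / q - (ℓ : ℝ) / n = 1 / (n * q / (n - ℓ * q)) := by
          field_simp
        rw [h1]
        gcongr
      · have h1 : 1 / q ≤ (ℓ : ℝ) / n := by
          rw [div_le_div_iff₀ hq0 hn0]
          linarith
        have h2 : 0 < 1 / r := by positivity
        linarith
    obtain ⟨c, hc, h⟩ := weighted_sobolev_poincare hn' A hp hpq hα hqp ℓ hr hexp
    exact ⟨c, hc, fun x₀ R a η u hR ha haA hη hu _ hmean => h x₀ R a η u hR ha haA hη hu hmean⟩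
  · obtain ⟨c, hc, h⟩ := weighted_sobolev_poincare hn' A hp hpq hα hqp 1 (r := q) (by linarith)
      (by
        have : (0 : ℝ) ≤ (1 : ℕ) / n := by positivity
        linarith)
    refine ⟨c, hc, fun x₀ R a η u hR ha haA hη hu _ hmean => ?_⟩
    have := h x₀ R a η u hR ha haA hη hu (fun σ hσ => by
      have hσ0 : σ = 0 := by
        funext i
        have := Finset.single_le_sum (f := σ) (fun _ _ => Nat.zero_le _) (Finset.mem_univ i)
        simp only [Pi.zero_apply]
        omega
      rw [hσ0, ← hmean, weightedMean, weightedMean]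
      congr 1
      refine integral_congr_ae ?_
      filter_upwards [hu.weakDeriv_zero_ae_eq Metric.isOpen_ball] with y hy
      rw [hy])
    simpa only [div_self hq0.ne', Real.rpow_one, pow_one] using this
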